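/- Let $\mathcal F_k$ be a real reproducing kernel Hilbert space of functions on a measurable space $\mathcal X$, with reproducing kernel $k$, and let $P, Q$ be probability measures on $\mathcal X$. Let $x_1,x_2,\dots\sim P$ and $y_1,y_2,\dots\sim Q$ be independent samples, so that the $z_a=(x_a,y_a)$ are i.i.d. with law $P\otimes Q$, and put $$h(z,z')=k(x,x')+k(y,y')-k(x,y')-k(x',y).$$ For $B\ge 2$ and $i\ge 1$ let $$\hat\eta_k(i)=\frac1{B(B-1)}\sum_{a=(i-1)B+1}^{iB}\ \sum_{\substack{b=(i-1)B+1\\ b\ne a}}^{iB}h(z_a,z_b)$$ be the estimate $\mathrm{MMD}_u$ on the $i$-th block of size $B$, and let $$\hat\eta_k=\frac1{\lfloor n/B\rfloor}\sum_{i=1}^{\lfloor n/B\rfloor}\hat\eta_k(i)$$ be its average over the complete blocks among the first $n$ sample points. Assume that $\mathbb E\,|k(x,x')|<\infty$ for $x,x'\sim P$ independent, and that $\mathbb E\,h(z,z')^2<\infty$ for $z,z'\sim P\otimes Q$ independent. Suppose that the null hypothesis $\mathcal H_0: P=Q$ holds. Let $$\bar k(u,v)=k(u,v)-\mathbb E_x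 k(u,x)-\mathbb E_x k(x,v)+\mathbb E_{x,x'}k(x,x')$$ be the centred kernel, and let $\lambda_l$ be the nonzero eigenvalues, listed with multiplicity, of the eigenvalue equation $\int_{\mathcal X}\bar k(x,x')\psi(x)\,dP(x)=\lambda\,\psi(x')$ (for $P$-almost every $x'$), $\psi\in L^2(P)$. Then: 1. every nonzero eigenvalue has finite multiplicity, and $\sum_l\lambda_l^2<\infty$; put $C=8\sum_l\lambda_l^2$; 2. for every $i$, each $\hat\eta_k(i)$ is square integrable and its variance is asymptotically $CB^{-2}$, that is, $B^2\operatorname{Var}(\hat\eta_k(i))\to C$ as $B\to\infty$; 3. $\hat\eta_k$ is asymptotically $\mathcal N(0,C(nB)^{-1})$: for all sequences of sample sizes $n_j$ and block sizes $B_j$ with $B_j\to\infty$ and $n_j/B_j\to\infty$, the statistics $\hat\eta_k$ formed with $n=n_j$ and $B=B_j$ satisfy $$\sqrt{n_jB_j}\;\hat\eta_k\ \xrightarrow{D}\ \mathcal N(0,C)\qquad(j\to\infty),$$ where $\mathcal N(0,0)$ is the point mass at $0$. -/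

import Mathlib

open MeasureTheory ProbabilityTheory Filter Topology

namespace BTest

noncomputable section

/-- The core `h(z, z') = k(x, x') + k(y, y') - k(x, y') - k(x', y)` of the MMD U-statistic, where
`z = (x, y)` and `z' = (x', y')`. -/
def core {X : Type*} (k : X → X → ℝ) (z z' : X × X) : ℝ :=
  k z.1 z'.1 + k z.2 z'.2 - k z.1 z'.2 - k z'.1 z.2

/-- The estimate `MMD_u` on the block of size `B` with index `i` (counted from `0`), that is, on the
sample points `z a` with `i * B ≤ a < (i + 1) * B`. -/
def blockMMD {X : Type*} (k : X → X → ℝ) (z : ℕ → X × X) (B i : ℕ) : ℝ :=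
  1 / ((B : ℝ) * ((B : ℝ) - 1)) *
    ∑ a ∈ Finset.Ico (i * B) ((i + 1) * B), ∑ b ∈ Finset.Ico (i * B) ((i + 1) * B) with b ≠ a,
      core k (z a) (z b)

/-- The B-test statistic: the average of `MMD_u` over the `⌊n / B⌋` complete blocks of size `B`
among the first `n` sample points. -/
def statistic {X : Type*} (k : X → X → ℝ) (z : ℕ → X × X) (n B : ℕ) : ℝ :=
  1 / ((n / B : ℕ) : ℝ) * ∑ i ∈ Finset.range (n / B), blockMMD k z B i

variable {X : Type*} [MeasurableSpace X]

/-- The kernel `k` centred with respect to the measure `P`. -/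
def centredKernel (k : X → X → ℝ) (P : Measure X) (x x' : X) : ℝ :=
  k x x' - (∫ u, k x u ∂P) - (∫ u, k u x' ∂P) + ∫ u, (∫ u', k u u' ∂P) ∂P

/-- The space of all `ψ ∈ L²(P)` that solve the eigenvalue equation
`∫ k̄(x, x') ψ(x) dP(x) = l ψ(x')` for `P`-almost every `x'`, with `k̄` the centred kernel. -/
def eigenspace (k : X → X → ℝ) (P : Measure X) (l : ℝ) : Submodule ℝ (Lp ℝ 2 P) where
  carrier := {ψ | ∀ᵐ x' ∂P, Integrable (fun x => centredKernel k P x x' * ψ x) P ∧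
    ∫ x, centredKernel k P x x' * ψ x ∂P = l * ψ x'}
  zero_mem' := by
    have h0 := Lp.coeFn_zero ℝ 2 P
    filter_upwards [h0] with x' hx'
    have h : (fun x => centredKernel k P x x' * (0 : Lp ℝ 2 P) x) =ᵐ[P] fun _ => (0 : ℝ) := by
      filter_upwards [h0] with x hx
      rw [hx, Pi.zero_apply, mul_zero]
    refine ⟨(integrable_zero X ℝ P).congr h.symm, ?_⟩
    rw [integral_congr_ae h, hx', integral_zero, Pi.zero_apply, mul_zero]
  add_mem' := by
    intro f g hf hg
    rw [Set.mem_ofPred_eq] at hf hg ⊢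
    have h0 := Lp.coeFn_add f g
    filter_upwards [h0, hf, hg] with x' hx' hf' hg'
    have h : (fun x => centredKernel k P x x' * (f + g : Lp ℝ 2 P) x) =ᵐ[P]
        fun x => centredKernel k P x x' * f x + centredKernel k P x x' * g x := by
      filter_upwards [h0] with x hx
      rw [hx, Pi.add_apply, mul_add]
    refine ⟨(hf'.1.add hg'.1).congr h.symm, ?_⟩
    rw [integral_congr_ae h, integral_add hf'.1 hg'.1, hf'.2, hg'.2, hx', Pi.add_apply, mul_add]
  smul_mem' := by
    intro c f hf
    rw [Set.mem_ofPred_eq] at hf ⊢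
    have h0 := Lp.coeFn_smul c f
    filter_upwards [h0, hf] with x' hx' hf'
    have h : (fun x => centredKernel k P x x' * (c • f : Lp ℝ 2 P) x) =ᵐ[P]
        fun x => c * (centredKernel k P x x' * f x) := by
      filter_upwards [h0] with x hx
      rw [hx, Pi.smul_apply, smul_eq_mul]
      ring
    refine ⟨(hf'.1.const_mul c).congr h.symm, ?_⟩
    rw [integral_congr_ae h, integral_const_mul, hf'.2, hx', Pi.smul_apply, smul_eq_mul]
    ring

/-- The contribution of the eigenvalue `l` to the sum of squared eigenvalues: its square times its
multiplicity. It is `0` if `l` is not an eigenvalue. -/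
def eigenvalueTerm (k : X → X → ℝ) (P : Measure X) (l : ℝ) : ℝ :=
  (Module.finrank ℝ (eigenspace k P l) : ℝ) * l ^ 2

/-- The constant `C = 8 ∑ λ_l²`, the sum being over the eigenvalues of the centred kernel, counted
with multiplicity. -/
def nullConstant (k : X → X → ℝ) (P : Measure X) : ℝ :=
  8 * ∑' l : ℝ, eigenvalueTerm k P l

end

end BTest

/-!
Under the null hypothesis `P = Q` the block statistics are degenerate U-statistics. The argument has
three parts, after the core `h` has been rewritten as the core of the centred kernel `k̄`
(`core_centredKernel`), a degenerate kernel in `L²(P ⊗ P)` (`memLp_two_centredKernel_of_core`).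

*Spectrum.* The eigenvalue equation says that `ψ` is an eigenvector of the integral operator `T`
with kernel `k̄`, which is the contraction of `k̄` against the tensor product on `L²(P)`
(`eigenspace_eq_eigenspace_contraction`). Elementary tensors are total in `L²(P ⊗ P)`, hence `T` is
a limit of finite rank operators and compact, and its nonzero eigenvalues have finite multiplicity.
The spectral theorem expands `k̄` in the orthonormal system `e ⊗ e` of tensor squares of
eigenvectors, with the eigenvalues as coefficients, so that `∑ λ² = ‖k̄‖²`
(`hasSum_finrank_eigenspace_contraction`). The four terms of the core are orthogonal, so
`E h² = 4 ‖k̄‖²` (`integral_core_sq`) and `C = 8 ∑ λ² = 2 E h²`.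

*Variance.* In the sum of `h (z a) (z b)` over the pairs `a < b` of a block the summands are
orthogonal, because a degenerate kernel at `(z a, z b)` is orthogonal to everything that does not
involve one of the two points (`IsIIDSample.integral_mul_kernel_eq_zero`). The variance of the block
statistic is therefore exactly `2 E h² / (B (B - 1))`, of the order `C / B²`.

*Normality.* The scaled block statistics `B η̂(i)` are independent, identically distributed for
fixed `B`, and have variance tending to `C`. Lindeberg's theorem applies once they satisfy the
Lindeberg condition uniformly in `B` (`tendsto_charFun_pow_of_lindeberg`). For a bounded degenerate
kernel this follows from a bound on the fourth moments, obtained by adding one row and one entry at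
a time (`IsIIDSample.integral_pairSum_pow_four_le`). In general `h` is approximated in `L²` by
bounded degenerate kernels, truncating and centring it (`exists_bounded_isDegenerate_approx`), and
the error is controlled by its variance (`IsIIDSample.tendsto_lindeberg_scaledPairSum`).

The core and the sample points are only almost everywhere measurable; both are replaced by
measurable versions at the end.
-/

/-! ### Contractions of tensors and the Hilbert–Schmidt trace formula -/

section Contraction

variable {E G : Type*} [NormedAddCommGroup E] [InnerProductSpace ℝ E] [CompleteSpace E]
  [NormedAddCommGroup G] [InnerProductSpace ℝ G] [CompleteSpace G]

/-- The contraction of `κ` against the bilinear map `t`: the operator `T` on `E` determined by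
`⟪T f, g⟫ = ⟪κ, t f g⟫`. If `t` is the tensor product of `L²` functions, this is the integral
operator with kernel `κ`. -/
noncomputable def contraction (t : E →L[ℝ] E →L[ℝ] G) : G →L[ℝ] E →L[ℝ] E :=
  LinearMap.mkContinuous₂
    (LinearMap.mk₂ ℝ (fun κ f => ContinuousLinearMap.adjoint (t f) κ)
      (fun _ _ _ => by simp) (fun _ _ _ => by simp) (fun _ _ _ => by simp)
      (fun _ _ _ => by simp)) ‖t‖ (fun κ f => by
        calc ‖ContinuousLinearMap.adjoint (t f) κ‖
            ≤ ‖ContinuousLinearMap.adjoint (t f)‖ * ‖κ‖ := ContinuousLinearMap.le_opNorm _ _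
          _ = ‖t f‖ * ‖κ‖ := by rw [LinearIsometryEquiv.norm_map]
          _ ≤ ‖t‖ * ‖f‖ * ‖κ‖ := by gcongr; exact t.le_opNorm f
          _ = ‖t‖ * ‖κ‖ * ‖f‖ := by ring)

theorem inner_contraction (t : E →L[ℝ] E →L[ℝ] G) (κ : G) (f g : E) :
    inner ℝ (contraction t κ f) g = inner ℝ κ (t f g) := by
  change inner ℝ (ContinuousLinearMap.adjoint (t f) κ) g = _
  rw [ContinuousLinearMap.adjoint_inner_left]

/-- If `t` preserves inner products and its values are total in `G`, every contraction is compact: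
it is a limit of contractions of finite sums of elementary tensors, which have finite rank. -/
theorem isCompactOperator_contraction (t : E →L[ℝ] E →L[ℝ] G)
    (ht : ∀ f g f' g', inner ℝ (t f g) (t f' g') = inner ℝ f f' * inner ℝ g g')
    (htot : ∀ r : G, (∀ f g, inner ℝ r (t f g) = 0) → r = 0) (κ : G) :
    IsCompactOperator (contraction t κ) := by
  have hclosed : IsClosed {κ : G | IsCompactOperator (contraction t κ)} :=
    isClosed_setOfPred_isCompactOperator.preimage (contraction t).continuous
  set K : Submodule ℝ G := Submodule.span ℝ {x | ∃ f g, x = t f g} with hK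
  have hsub : (K : Set G) ⊆ {κ : G | IsCompactOperator (contraction t κ)} := by
    intro x hx
    induction hx using Submodule.span_induction with
    | mem x hx =>
      obtain ⟨a, b, rfl⟩ := hx
      have : contraction t (t a b) = (innerSL ℝ a).smulRight b := by
        ext1 f
        refine ext_inner_right ℝ fun g => ?_
        rw [inner_contraction, ht]
        simp [inner_smul_left]
      change IsCompactOperator (contraction t (t a b))
      rw [this]
      have hc : IsCompactOperator ((ContinuousLinearMap.id ℝ ℝ).smulRight b) :=
        isCompactOperator_of_locallyCompactSpace_rng _
      exact hc.comp_clm (innerSL ℝ a)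
    | zero =>
      change IsCompactOperator (contraction t 0)
      rw [map_zero]; exact isCompactOperator_zero
    | add x y _ _ hx hy =>
      change IsCompactOperator (contraction t (x + y))
      rw [map_add]; exact IsCompactOperator.add hx hy
    | smul c x _ hx =>
      change IsCompactOperator (contraction t (c • x))
      rw [map_smul]; exact IsCompactOperator.smul hx c
  have hdense : K.topologicalClosure = ⊤ := by
    rw [Submodule.topologicalClosure_eq_top_iff, Submodule.eq_bot_iff]
    intro r hr
    refine htot r fun f g => ?_
    rw [real_inner_comm]
    exact hr _ (Submodule.subset_span ⟨f, g, rfl⟩)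
  have hmem : κ ∈ closure (K : Set G) := by
    rw [← Submodule.topologicalClosure_coe, hdense]; trivial
  exact (closure_minimal hsub hclosed) hmem

/-- The Hilbert–Schmidt trace formula: for a symmetric contraction, `‖κ‖²` is the sum of the squared
eigenvalues, counted with multiplicity. The spectral theorem gives `κ = ∑ λᵢ eᵢ ⊗ eᵢ`, the `eᵢ`
being orthonormal eigenvectors for the nonzero eigenvalues. -/
theorem hasSum_finrank_eigenspace_contraction (t : E →L[ℝ] E →L[ℝ] G)
    (ht : ∀ f g f' g', inner ℝ (t f g) (t f' g') = inner ℝ f f' * inner ℝ g g')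
    (htot : ∀ r : G, (∀ f g, inner ℝ r (t f g) = 0) → r = 0) (κ : G)
    (hκ : ∀ f g, inner ℝ κ (t f g) = inner ℝ κ (t g f)) :
    HasSum (fun l : ℝ => (Module.finrank ℝ
      (Module.End.eigenspace (contraction t κ : Module.End ℝ E) l) : ℝ) * l ^ 2) (‖κ‖ ^ 2) := by
  set T := contraction t κ with hT
  have hcomp : IsCompactOperator T := isCompactOperator_contraction t ht htot κ
  have hsymm : (T : E →ₗ[ℝ] E).IsSymmetric := by
    intro f g
    change inner ℝ (T f) g = inner ℝ f (T g)
    rw [real_inner_comm (T g) f, inner_contraction, inner_contraction, hκ]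
  -- index an orthonormal family of eigenvectors by pairs (nonzero eigenvalue, basis index)
  have hfin (l : {l : ℝ // l ≠ 0}) :
      FiniteDimensional ℝ (Module.End.eigenspace (T : Module.End ℝ E) l) :=
    ContinuousLinearMap.finite_dimensional_eigenspace hcomp l l.2
  set d : {l : ℝ // l ≠ 0} → ℕ := fun l =>
    Module.finrank ℝ (Module.End.eigenspace (T : Module.End ℝ E) l) with hd
  let b (l : {l : ℝ // l ≠ 0}) := stdOrthonormalBasis ℝ
    (Module.End.eigenspace (T : Module.End ℝ E) (l : ℝ))
  set e : (Σ l : {l : ℝ // l ≠ 0}, Fin (d l)) → E := fun p => (b p.1 p.2 : E) with he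
  have hTe (p) : T (e p) = (p.1 : ℝ) • e p :=
    Module.End.mem_eigenspace_iff.1 (b p.1 p.2).2
  have hes : Orthonormal ℝ e := by
    have hV := hsymm.orthogonalFamily_eigenspaces.comp (Subtype.val_injective (p := fun l => l ≠ 0))
    exact hV.orthonormal_sigma_orthonormal (v_family := fun l i => b l i)
      fun l => (b l).orthonormal
  have hinner (p q) : inner ℝ (e p) (e q) = if p = q then (1 : ℝ) else 0 :=
    (orthonormal_iff_ite.1 hes) p q
  set v : (Σ l : {l : ℝ // l ≠ 0}, Fin (d l)) → G := fun p => t (e p) (e p) with hv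
  have hvs : Orthonormal ℝ v := by
    rw [orthonormal_iff_ite]
    intro p q
    rw [ht, hinner]
    split_ifs <;> simp
  have hκv (p) : inner ℝ κ (v p) = (p.1 : ℝ) := by
    rw [hv, ← inner_contraction, ← hT, hTe, inner_smul_left, hinner]
    simp
  have hV : OrthogonalFamily ℝ (fun _ : (Σ l : {l : ℝ // l ≠ 0}, Fin (d l)) => ℝ)
      fun p => LinearIsometry.toSpanSingleton ℝ G (hvs.1 p) := hvs.orthogonalFamily
  -- Bessel's inequality: the `λ_p = ⟪κ, v p⟫` are square summable, so `κ' = ∑ λ_p v p` exists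
  have hsq : Summable fun p : (Σ l : {l : ℝ // l ≠ 0}, Fin (d l)) => ‖(p.1 : ℝ)‖ ^ 2 := by
    have := hvs.inner_products_summable κ
    simpa [real_inner_comm, hκv] using this
  have hsum : Summable fun p : (Σ l : {l : ℝ // l ≠ 0}, Fin (d l)) => (p.1 : ℝ) • v p := by
    have := (hV.summable_iff_norm_sq_summable fun p => (p.1 : ℝ)).2 hsq
    simpa using this
  obtain ⟨κ', hκ'⟩ := hsum
  have hκ'in (x : G) : HasSum (fun p : (Σ l : {l : ℝ // l ≠ 0}, Fin (d l)) =>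
      (p.1 : ℝ) * inner ℝ (v p) x) (inner ℝ κ' x) := by
    have := (innerSL ℝ x).hasSum hκ'
    simpa [inner_smul_right, real_inner_comm] using this
  -- `κ` and `κ'` induce the same operator: compare them on each eigenspace of `T`
  have heq : κ = κ' := by
    rw [← sub_eq_zero]
    set r := κ - κ' with hr
    set R := contraction t r with hR
    have hker : (⨆ l, Module.End.eigenspace (T : Module.End ℝ E) l) ≤
        LinearMap.ker (R : E →ₗ[ℝ] E) := by
      refine iSup_le fun l f hf => ?_
      rw [Module.End.mem_eigenspace_iff] at hf
      change T f = l • f at hf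
      rw [LinearMap.mem_ker]
      change R f = 0
      refine ext_inner_right ℝ fun g => ?_
      rw [hR, inner_contraction, hr, inner_sub_left, inner_zero_left, ← inner_contraction, ← hT, hf,
        inner_smul_left, sub_eq_zero]
      have h1 := hκ'in (t f g)
      refine HasSum.unique ?_ h1
      have h3 (p : Σ l : {l : ℝ // l ≠ 0}, Fin (d l)) :
          (p.1 : ℝ) * inner ℝ (e p) f = l * inner ℝ (e p) f := by
        have := hsymm (e p) f
        change inner ℝ (T (e p)) f = inner ℝ (e p) (T f) at this
        rwa [hTe, hf, inner_smul_left, inner_smul_right] at this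
      have h2 (p : Σ l : {l : ℝ // l ≠ 0}, Fin (d l)) :
          (p.1 : ℝ) * inner ℝ (v p) (t f g) = l * (inner ℝ (e p) f * inner ℝ (e p) g) := by
        rw [hv, ht, ← mul_assoc, h3 p, mul_assoc]
      simp_rw [h2]
      by_cases hl : l = 0
      · simp [hl]
      · refine HasSum.mul_left l ?_
        have hf' : f ∈ Module.End.eigenspace (T : Module.End ℝ E)
            ((⟨l, hl⟩ : {l : ℝ // l ≠ 0}) : ℝ) :=
          Module.End.mem_eigenspace_iff.2 hf
        have hinj : Function.Injective (fun i : Fin (d ⟨l, hl⟩) =>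
            (⟨⟨l, hl⟩, i⟩ : Σ l : {l : ℝ // l ≠ 0}, Fin (d l))) :=
          fun i j h => by simpa using h
        rw [← hinj.hasSum_iff]
        · have h4 : f = ∑ i, inner ℝ (e ⟨⟨l, hl⟩, i⟩) f • e ⟨⟨l, hl⟩, i⟩ := by
            have := congrArg Subtype.val ((b ⟨l, hl⟩).sum_repr' ⟨f, hf'⟩)
            simpa using this.symm
          have h5 : inner ℝ f g = ∑ i, inner ℝ (e ⟨⟨l, hl⟩, i⟩) f * inner ℝ (e ⟨⟨l, hl⟩, i⟩) g := by
            conv_lhs => rw [h4]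
            rw [sum_inner]
            simp [inner_smul_left]
          rw [h5]
          exact hasSum_fintype _
        · intro p hp
          have h6 : (p.1 : ℝ) ≠ l := by
            rintro rfl
            exact hp ⟨p.2, rfl⟩
          have h7 : inner ℝ (e p) f = 0 := by
            by_contra h
            exact h6 (mul_right_cancel₀ h (h3 p))
          rw [h7, zero_mul]
    have hbot := ContinuousLinearMap.orthogonalComplement_iSup_eigenspaces_eq_bot hcomp hsymm
    have hR0 : ∀ f, R f = 0 := by
      have hcl : IsClosed ((LinearMap.ker (R : E →ₗ[ℝ] E) : Submodule ℝ E) : Set E) :=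
        R.isClosed_ker
      have hle := Submodule.topologicalClosure_minimal _ hker hcl
      rw [Submodule.topologicalClosure_eq_top_iff.2 hbot] at hle
      exact fun f => hle (Submodule.mem_top (x := f))
    refine htot r fun f g => ?_
    rw [← inner_contraction, ← hR, hR0, inner_zero_left]
  have hnorm : HasSum (fun p : (Σ l : {l : ℝ // l ≠ 0}, Fin (d l)) => (p.1 : ℝ) ^ 2) (‖κ‖ ^ 2) := by
    have := hκ'in κ
    rw [← heq, real_inner_self_eq_norm_sq] at this
    convert! this using 2 with p
    rw [real_inner_comm, hκv, sq]
  have hsub : HasSum (fun l : {l : ℝ // l ≠ 0} => (d l : ℝ) * (l : ℝ) ^ 2) (‖κ‖ ^ 2) := by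
    refine hnorm.sigma fun l => ?_
    have := hasSum_fintype (fun _ : Fin (d l) => (l : ℝ) ^ 2)
    simpa using this
  have := (hasSum_subtype_iff_of_support_subset (f := fun l : ℝ => (Module.finrank ℝ
      (Module.End.eigenspace (T : Module.End ℝ E) l) : ℝ) * l ^ 2) (s := {l | l ≠ 0})
      (fun l hl => by
        intro h
        simp [h] at hl)).1 hsub
  exact this

end Contraction

/-! ### The integral operator of the centred kernel -/

section Tensor

variable {X : Type*} [MeasurableSpace X] {P : Measure X} [IsProbabilityMeasure P]

omit [IsProbabilityMeasure P] in
theorem memLp_two_mul_prod {f g : X → ℝ} (hf : MemLp f 2 P) (hg : MemLp g 2 P) :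
    MemLp (fun p : X × X => f p.1 * g p.2) 2 (P.prod P) := by
  refine (memLp_two_iff_integrable_sq (hf.1.comp_fst.mul hg.1.comp_snd)).2 ?_
  simpa [mul_pow] using hf.integrable_sq.mul_prod hg.integrable_sq

theorem inner_toLp_mul_prod {f g f' g' : X → ℝ} (hf : MemLp f 2 P) (hg : MemLp g 2 P)
    (hf' : MemLp f' 2 P) (hg' : MemLp g' 2 P) :
    inner ℝ ((memLp_two_mul_prod hf hg).toLp _) ((memLp_two_mul_prod hf' hg').toLp _) =
      (∫ x, f x * f' x ∂P) * ∫ x, g x * g' x ∂P := by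
  rw [L2.inner_def, ← integral_prod_mul]
  refine integral_congr_ae ?_
  filter_upwards [(memLp_two_mul_prod hf hg).coeFn_toLp, (memLp_two_mul_prod hf' hg').coeFn_toLp]
    with p hp hp'
  rw [hp, hp']
  simp only [RCLike.inner_apply, conj_trivial]
  ring

omit [IsProbabilityMeasure P] in
theorem L2_inner_eq_integral_mul (f g : Lp ℝ 2 P) : inner ℝ f g = ∫ x, f x * g x ∂P := by
  rw [L2.inner_def]
  simp [mul_comm]

/-- The tensor product `(f ⊗ g) (x, x') = f x * g x'` of two square integrable functions. -/
noncomputable def tensorLp (P : Measure X) [IsProbabilityMeasure P] :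
    Lp ℝ 2 P →L[ℝ] Lp ℝ 2 P →L[ℝ] Lp ℝ 2 (P.prod P) :=
  LinearMap.mkContinuous₂
    (LinearMap.mk₂ ℝ (fun f g => (memLp_two_mul_prod (Lp.memLp f) (Lp.memLp g)).toLp _)
      (fun f f' g => by
        rw [← MemLp.toLp_add]
        refine MemLp.toLp_congr _ _ ?_
        filter_upwards [Measure.quasiMeasurePreserving_fst.ae (Lp.coeFn_add f f')] with p hp
        change (f + f' : Lp ℝ 2 P) p.1 * g p.2 = f p.1 * g p.2 + f' p.1 * g p.2
        rw [hp, Pi.add_apply, add_mul])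
      (fun c f g => by
        rw [← MemLp.toLp_const_smul]
        refine MemLp.toLp_congr _ _ ?_
        filter_upwards [Measure.quasiMeasurePreserving_fst.ae (Lp.coeFn_smul c f)] with p hp
        simp [hp, mul_assoc])
      (fun f g g' => by
        rw [← MemLp.toLp_add]
        refine MemLp.toLp_congr _ _ ?_
        filter_upwards [Measure.quasiMeasurePreserving_snd.ae (Lp.coeFn_add g g')] with p hp
        change f p.1 * (g + g' : Lp ℝ 2 P) p.2 = f p.1 * g p.2 + f p.1 * g' p.2
        rw [hp, Pi.add_apply, mul_add])
      (fun c f g => by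
        rw [← MemLp.toLp_const_smul]
        refine MemLp.toLp_congr _ _ ?_
        filter_upwards [Measure.quasiMeasurePreserving_snd.ae (Lp.coeFn_smul c g)] with p hp
        simp [hp, mul_left_comm])) 1 (fun f g => by
    rw [one_mul]
    refine le_of_eq ?_
    rw [← sq_eq_sq₀ (norm_nonneg _) (by positivity), mul_pow, ← real_inner_self_eq_norm_sq,
      ← real_inner_self_eq_norm_sq, ← real_inner_self_eq_norm_sq, L2_inner_eq_integral_mul f,
      L2_inner_eq_integral_mul g]
    exact inner_toLp_mul_prod (Lp.memLp f) (Lp.memLp g) (Lp.memLp f) (Lp.memLp g))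

theorem coeFn_tensorLp (f g : Lp ℝ 2 P) :
    tensorLp P f g =ᵐ[P.prod P] fun p => f p.1 * g p.2 :=
  (memLp_two_mul_prod (Lp.memLp f) (Lp.memLp g)).coeFn_toLp

theorem inner_tensorLp (f g f' g' : Lp ℝ 2 P) :
    inner ℝ (tensorLp P f g) (tensorLp P f' g') = inner ℝ f f' * inner ℝ g g' := by
  rw [L2_inner_eq_integral_mul f, L2_inner_eq_integral_mul g]
  exact inner_toLp_mul_prod (Lp.memLp f) (Lp.memLp g) (Lp.memLp f') (Lp.memLp g')

theorem inner_tensorLp_right (r : Lp ℝ 2 (P.prod P)) (f g : Lp ℝ 2 P) :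
    inner ℝ r (tensorLp P f g) = ∫ p, r p * (f p.1 * g p.2) ∂(P.prod P) := by
  rw [L2_inner_eq_integral_mul]
  refine integral_congr_ae ?_
  filter_upwards [coeFn_tensorLp f g] with p hp
  rw [hp]

omit [IsProbabilityMeasure P] in
theorem integrable_mul_tensor {κ : X × X → ℝ} (hκ : MemLp κ 2 (P.prod P)) (f g : Lp ℝ 2 P) :
    Integrable (fun p => κ p * (f p.1 * g p.2)) (P.prod P) :=
  hκ.integrable_mul (memLp_two_mul_prod (Lp.memLp f) (Lp.memLp g))

/-- Elementary tensors are total in `L²(P ⊗ P)`, since the measurable rectangles generate the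
product `σ`-algebra. -/
theorem eq_zero_of_inner_tensorLp_eq_zero (r : Lp ℝ 2 (P.prod P))
    (h : ∀ f g, inner ℝ r (tensorLp P f g) = 0) : r = 0 := by
  have hint : Integrable r (P.prod P) := (Lp.memLp r).integrable (by norm_num)
  have hrect {A B : Set X} (hA : MeasurableSet A) (hB : MeasurableSet B) :
      ∫ p in A ×ˢ B, r p ∂(P.prod P) = 0 := by
    have := h (indicatorConstLp 2 hA (measure_ne_top P A) 1)
      (indicatorConstLp 2 hB (measure_ne_top P B) 1)
    rw [inner_tensorLp_right] at this
    rw [← integral_indicator (hA.prod hB), ← this]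
    refine integral_congr_ae ?_
    filter_upwards [Measure.quasiMeasurePreserving_fst.ae
      (indicatorConstLp_coeFn (p := 2) (hs := hA) (hμs := measure_ne_top P A) (c := (1 : ℝ))),
      Measure.quasiMeasurePreserving_snd.ae (indicatorConstLp_coeFn (p := 2) (hs := hB)
      (hμs := measure_ne_top P B) (c := (1 : ℝ)))] with p h1 h2
    rw [h1, h2]
    by_cases hpA : p.1 ∈ A <;> by_cases hpB : p.2 ∈ B <;> simp [Set.indicator, hpA, hpB]
  have hall (s : Set (X × X)) (hs : MeasurableSet s) : ∫ p in s, r p ∂(P.prod P) = 0 := by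
    induction s, hs using MeasurableSpace.induction_on_inter generateFrom_prod.symm
      isPiSystem_prod with
    | empty => simp
    | basic t ht =>
      obtain ⟨A, hA, B, hB, rfl⟩ := ht
      exact hrect hA hB
    | compl t htm ih =>
      have h1 := integral_add_compl htm hint
      have h2 := hrect MeasurableSet.univ MeasurableSet.univ
      rw [Set.univ_prod_univ, Measure.restrict_univ] at h2
      rw [ih, h2, zero_add] at h1
      exact h1
    | iUnion f hd hm ih =>
      rw [integral_iUnion hm hd hint.integrableOn]
      simp [ih]
  have hae : r =ᵐ[P.prod P] (0 : X × X → ℝ) :=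
    Integrable.ae_eq_of_forall_setIntegral_eq _ _ hint (integrable_zero _ _ _)
      fun s hs _ => by simp [hall s hs]
  exact Lp.ext (hae.trans (Lp.coeFn_zero ℝ 2 _).symm)

end Tensor

section CentredSpectrum

variable {X : Type*} [MeasurableSpace X] {P : Measure X} [IsProbabilityMeasure P]

/-- The solutions of the integral equation are the eigenvectors of the integral operator, viewed as
the contraction of the kernel. -/
theorem eigenspace_eq_eigenspace_contraction {k : X → X → ℝ}
    (hL : MemLp (fun p : X × X => BTest.centredKernel k P p.1 p.2) 2 (P.prod P)) (l : ℝ) :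
    BTest.eigenspace k P l =
      Module.End.eigenspace
        (contraction (tensorLp P) (hL.toLp _) : Module.End ℝ (Lp ℝ 2 P)) l := by
  ext ψ
  set κ : X × X → ℝ := fun p => BTest.centredKernel k P p.1 p.2 with hκ
  have hin (g : Lp ℝ 2 P) : inner ℝ (contraction (tensorLp P) (hL.toLp _) ψ) g =
      ∫ x', (∫ x, κ (x, x') * ψ x ∂P) * g x' ∂P := by
    rw [inner_contraction, inner_tensorLp_right]
    have h1 : ∫ p, (hL.toLp κ) p * (ψ p.1 * g p.2) ∂(P.prod P) =
        ∫ p, κ p * (ψ p.1 * g p.2) ∂(P.prod P) := by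
      refine integral_congr_ae ?_
      filter_upwards [hL.coeFn_toLp] with p hp
      rw [hp]
    rw [h1, integral_prod_symm _ (integrable_mul_tensor hL ψ g)]
    congr 1 with x'
    rw [← integral_mul_const]
    simp_rw [mul_assoc]
  have hint : Integrable (fun p : X × X => κ p * ψ p.1) (P.prod P) :=
    hL.integrable_mul ((Lp.memLp ψ).comp_fst P)
  have hsec : ∀ᵐ x' ∂P, Integrable (fun x => κ (x, x') * ψ x) P := hint.prod_left_ae
  have hmem : ψ ∈ BTest.eigenspace k P l ↔
      ∀ᵐ x' ∂P, Integrable (fun x => κ (x, x') * ψ x) P ∧ ∫ x, κ (x, x') * ψ x ∂P = l * ψ x' :=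
    Iff.rfl
  rw [hmem, Module.End.mem_eigenspace_iff]
  constructor
  · intro h
    refine ext_inner_right ℝ fun g => ?_
    change inner ℝ (contraction (tensorLp P) (hL.toLp _) ψ) g = _
    rw [hin, inner_smul_left, L2_inner_eq_integral_mul, conj_trivial, ← integral_const_mul]
    refine integral_congr_ae ?_
    filter_upwards [h] with x' hx'
    rw [hx'.2, mul_assoc]
  · intro h
    change contraction (tensorLp P) (hL.toLp _) ψ = _ at h
    have hae : (fun x' => ∫ x, κ (x, x') * ψ x ∂P) =ᵐ[P] fun x' => l * ψ x' := by
      refine Integrable.ae_eq_of_forall_setIntegral_eq _ _ hint.integral_prod_right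
        (((Lp.memLp ψ).integrable (by norm_num)).const_mul l) fun s hs _ => ?_
      have h1 := hin (indicatorConstLp 2 hs (measure_ne_top P s) 1)
      rw [h, inner_smul_left, L2_inner_eq_integral_mul, conj_trivial, ← integral_const_mul] at h1
      rw [← integral_indicator hs, ← integral_indicator hs]
      have h2 (F : X → ℝ) : ∫ x, F x * (indicatorConstLp 2 hs (measure_ne_top P s) (1 : ℝ)) x ∂P =
          ∫ x, s.indicator F x ∂P := by
        refine integral_congr_ae ?_
        filter_upwards [indicatorConstLp_coeFn (p := 2) (hs := hs)
          (hμs := measure_ne_top P s) (c := (1 : ℝ))] with x hx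
        rw [hx]
        by_cases hxs : x ∈ s <;> simp [hxs]
      simp_rw [← mul_assoc] at h1
      rw [h2, h2] at h1
      exact h1.symm
    filter_upwards [hsec, hae] with x' h1 h2
    exact ⟨h1, h2⟩

theorem finiteDimensional_eigenspace {k : X → X → ℝ}
    (hL : MemLp (fun p : X × X => BTest.centredKernel k P p.1 p.2) 2 (P.prod P)) {l : ℝ}
    (hl : l ≠ 0) : FiniteDimensional ℝ (BTest.eigenspace k P l) := by
  rw [eigenspace_eq_eigenspace_contraction hL]
  exact ContinuousLinearMap.finite_dimensional_eigenspace
    (isCompactOperator_contraction _ inner_tensorLp eq_zero_of_inner_tensorLp_eq_zero _) l hl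

/-- The trace formula `∑ λ² = ‖k̄‖²` for the centred kernel. -/
theorem hasSum_eigenvalueTerm {k : X → X → ℝ}
    (hL : MemLp (fun p : X × X => BTest.centredKernel k P p.1 p.2) 2 (P.prod P))
    (hsymm : ∀ x x', BTest.centredKernel k P x x' = BTest.centredKernel k P x' x) :
    HasSum (BTest.eigenvalueTerm k P)
      (∫ p, BTest.centredKernel k P p.1 p.2 ^ 2 ∂(P.prod P)) := by
  have h := hasSum_finrank_eigenspace_contraction (tensorLp P) inner_tensorLp
    eq_zero_of_inner_tensorLp_eq_zero (hL.toLp _) (fun f g => by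
      have h1 (f g : Lp ℝ 2 P) : inner ℝ (hL.toLp _) (tensorLp P f g) =
          ∫ p, BTest.centredKernel k P p.1 p.2 * (f p.1 * g p.2) ∂(P.prod P) := by
        rw [inner_tensorLp_right]
        refine integral_congr_ae ?_
        filter_upwards [hL.coeFn_toLp] with p hp
        rw [hp]
      rw [h1, h1, ← integral_prod_swap]
      congr 1 with p
      rw [Prod.fst_swap, Prod.snd_swap, hsymm, mul_comm (f p.2)])
  have hnorm : ‖hL.toLp _‖ ^ 2 = ∫ p, BTest.centredKernel k P p.1 p.2 ^ 2 ∂(P.prod P) := by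
    rw [← real_inner_self_eq_norm_sq, L2_inner_eq_integral_mul]
    refine integral_congr_ae ?_
    filter_upwards [hL.coeFn_toLp] with p hp
    rw [hp, sq]
  rw [hnorm] at h
  have hterm : BTest.eigenvalueTerm k P = fun l : ℝ => (Module.finrank ℝ (Module.End.eigenspace
      (contraction (tensorLp P) (hL.toLp _) : Module.End ℝ (Lp ℝ 2 P)) l) : ℝ) * l ^ 2 := by
    ext l
    rw [BTest.eigenvalueTerm, eigenspace_eq_eigenspace_contraction hL]
  rw [hterm]
  exact h

end CentredSpectrum

/-! ### Degenerate kernels, centring and the core -/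

/-- `Integrable.sub` with the difference written pointwise, the form in which `integral_add` and
`integral_sub` have to find it when rewriting. -/
theorem MeasureTheory.Integrable.fun_sub {α E : Type*} [MeasurableSpace α]
    [NormedAddCommGroup E] {μ : Measure α} {f g : α → E} (hf : Integrable f μ)
    (hg : Integrable g μ) : Integrable (fun x => f x - g x) μ :=
  hf.sub hg

section Jensen

variable {α β : Type*} [MeasurableSpace α] [MeasurableSpace β] {μ : Measure α} {ν : Measure β}
  [IsProbabilityMeasure μ] [IsProbabilityMeasure ν]

theorem sq_integral_le_integral_sq {f : β → ℝ} (hf : MemLp f 2 ν) :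
    (∫ y, f y ∂ν) ^ 2 ≤ ∫ y, f y ^ 2 ∂ν := by
  have h := variance_nonneg f ν
  rw [variance_eq_sub hf] at h
  simpa using h

theorem ae_memLp_two_prod_right {F : α × β → ℝ} (hF : MemLp F 2 (μ.prod ν)) :
    ∀ᵐ x ∂μ, MemLp (fun y => F (x, y)) 2 ν := by
  filter_upwards [hF.integrable_sq.prod_right_ae, hF.1.prodMk_left] with x hx hx'
  exact (memLp_two_iff_integrable_sq hx').2 hx

theorem ae_sq_integral_prod_right_le {F : α × β → ℝ} (hF : MemLp F 2 (μ.prod ν)) :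
    ∀ᵐ x ∂μ, (∫ y, F (x, y) ∂ν) ^ 2 ≤ ∫ y, F (x, y) ^ 2 ∂ν := by
  filter_upwards [ae_memLp_two_prod_right hF] with x hx using sq_integral_le_integral_sq hx

theorem memLp_two_integral_prod_right {F : α × β → ℝ} (hF : MemLp F 2 (μ.prod ν)) :
    MemLp (fun x => ∫ y, F (x, y) ∂ν) 2 μ := by
  have hm : AEStronglyMeasurable (fun x => ∫ y, F (x, y) ∂ν) μ := hF.1.integral_prod_right'
  refine (memLp_two_iff_integrable_sq hm).2 ?_
  refine hF.integrable_sq.integral_prod_left.mono' (hm.pow 2) ?_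
  filter_upwards [ae_sq_integral_prod_right_le hF] with x hx
  rwa [Real.norm_of_nonneg (sq_nonneg _)]

theorem integral_sq_integral_prod_right_le {F : α × β → ℝ} (hF : MemLp F 2 (μ.prod ν)) :
    ∫ x, (∫ y, F (x, y) ∂ν) ^ 2 ∂μ ≤ ∫ p, F p ^ 2 ∂(μ.prod ν) := by
  rw [integral_prod _ hF.integrable_sq]
  exact integral_mono_ae (memLp_two_integral_prod_right hF).integrable_sq
    hF.integrable_sq.integral_prod_left (ae_sq_integral_prod_right_le hF)

end Jensen

section Centring

variable {Z : Type*} [MeasurableSpace Z] {ν : Measure Z} [IsProbabilityMeasure ν]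

/-- The defining property of a degenerate kernel: both partial integrals vanish almost
everywhere. -/
def IsDegenerate (g : Z → Z → ℝ) (ν : Measure Z) : Prop :=
  (∀ᵐ x ∂ν, ∫ y, g x y ∂ν = 0) ∧ ∀ᵐ y ∂ν, ∫ x, g x y ∂ν = 0

theorem isDegenerate_centredKernel {g : Z → Z → ℝ}
    (hg : Integrable (fun p : Z × Z => g p.1 p.2) (ν.prod ν)) :
    IsDegenerate (BTest.centredKernel g ν) ν := by
  have hr : Integrable (fun y => ∫ u, g u y ∂ν) ν := hg.integral_prod_right
  have hl : Integrable (fun x => ∫ u, g x u ∂ν) ν := hg.integral_prod_left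
  constructor
  · filter_upwards [hg.prod_right_ae] with x hx
    have hx' : Integrable (fun y => g x y) ν := hx
    have h1 := integral_prod_symm _ hg
    rw [integral_prod _ hg] at h1
    simp only [BTest.centredKernel]
    rw [integral_add ((hx'.fun_sub (integrable_const _)).fun_sub hr) (integrable_const _),
      integral_sub (hx'.fun_sub (integrable_const _)) hr, integral_sub hx' (integrable_const _)]
    simp only [integral_const, probReal_univ, one_smul]
    linarith
  · filter_upwards [hg.prod_left_ae] with y hy
    have hy' : Integrable (fun x => g x y) ν := hy
    simp only [BTest.centredKernel]
    rw [integral_add ((hy'.fun_sub hl).fun_sub (integrable_const _)) (integrable_const _),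
      integral_sub (hy'.fun_sub hl) (integrable_const _), integral_sub hy' hl]
    simp only [integral_const, probReal_univ, one_smul]
    linarith

omit [IsProbabilityMeasure ν] in
theorem centredKernel_ae_eq_of_isDegenerate {g : Z → Z → ℝ} (hg : IsDegenerate g ν) :
    ∀ᵐ p ∂(ν.prod ν), BTest.centredKernel g ν p.1 p.2 = g p.1 p.2 := by
  filter_upwards [Measure.quasiMeasurePreserving_fst.ae hg.1,
    Measure.quasiMeasurePreserving_snd.ae hg.2] with p h1 h2
  rw [BTest.centredKernel, h1, h2, integral_eq_zero_of_ae hg.1]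
  ring

theorem centredKernel_sub_ae_eq {f g : Z → Z → ℝ}
    (hf : Integrable (fun p : Z × Z => f p.1 p.2) (ν.prod ν))
    (hg : Integrable (fun p : Z × Z => g p.1 p.2) (ν.prod ν)) :
    ∀ᵐ p ∂(ν.prod ν), BTest.centredKernel (fun x y => f x y - g x y) ν p.1 p.2 =
      BTest.centredKernel f ν p.1 p.2 - BTest.centredKernel g ν p.1 p.2 := by
  have h0 : ∫ u, (∫ u', (f u u' - g u u') ∂ν) ∂ν =
      (∫ u, (∫ u', f u u' ∂ν) ∂ν) - ∫ u, (∫ u', g u u' ∂ν) ∂ν :=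
    integral_integral_sub hf hg
  filter_upwards [Measure.quasiMeasurePreserving_fst.ae hf.prod_right_ae,
    Measure.quasiMeasurePreserving_snd.ae hf.prod_left_ae,
    Measure.quasiMeasurePreserving_fst.ae hg.prod_right_ae,
    Measure.quasiMeasurePreserving_snd.ae hg.prod_left_ae] with p h1 h2 h3 h4
  simp only [BTest.centredKernel]
  rw [h0, integral_sub h1 h3, integral_sub h2 h4]
  ring

/-- Centring is bounded on `L²`; the constant `16` is crude but suffices. -/
theorem memLp_two_centredKernel {g : Z → Z → ℝ}
    (hg : MemLp (fun p : Z × Z => g p.1 p.2) 2 (ν.prod ν)) :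
    MemLp (fun p : Z × Z => BTest.centredKernel g ν p.1 p.2) 2 (ν.prod ν) ∧
    ∫ p, BTest.centredKernel g ν p.1 p.2 ^ 2 ∂(ν.prod ν) ≤
      16 * ∫ p, g p.1 p.2 ^ 2 ∂(ν.prod ν) := by
  have hsw : MemLp (fun p : Z × Z => g p.2 p.1) 2 (ν.prod ν) :=
    hg.comp_measurePreserving Measure.measurePreserving_swap
  have hA := memLp_two_integral_prod_right hg
  have hA' := integral_sq_integral_prod_right_le hg
  have hB := memLp_two_integral_prod_right hsw
  have hB' := integral_sq_integral_prod_right_le hsw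
  have hswi : ∫ p : Z × Z, g p.2 p.1 ^ 2 ∂(ν.prod ν) = ∫ p, g p.1 p.2 ^ 2 ∂(ν.prod ν) :=
    integral_prod_swap (fun p : Z × Z => g p.1 p.2 ^ 2)
  have hC := sq_integral_le_integral_sq hA
  simp only at hA hA' hB hB' hC
  rw [hswi] at hB'
  have hA2 := hA.comp_fst ν
  have hB2 := hB.comp_snd ν
  have hmem : MemLp (fun p : Z × Z => BTest.centredKernel g ν p.1 p.2) 2 (ν.prod ν) :=
    ((hg.sub hA2).sub hB2).add (memLp_const _)
  refine ⟨hmem, ?_⟩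
  set c := ∫ u, (∫ u', g u u' ∂ν) ∂ν with hc
  have hAi : ∫ p : Z × Z, (∫ u, g p.1 u ∂ν) ^ 2 ∂(ν.prod ν) = ∫ x, (∫ u, g x u ∂ν) ^ 2 ∂ν := by
    rw [integral_fun_fst (f := fun x => (∫ u, g x u ∂ν) ^ 2)]; simp
  have hBi : ∫ p : Z × Z, (∫ u, g u p.2 ∂ν) ^ 2 ∂(ν.prod ν) = ∫ x, (∫ u, g u x ∂ν) ^ 2 ∂ν := by
    rw [integral_fun_snd (f := fun x => (∫ u, g u x ∂ν) ^ 2)]; simp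
  have hbound : ∫ p, BTest.centredKernel g ν p.1 p.2 ^ 2 ∂(ν.prod ν) ≤
      ∫ p : Z × Z, (4 * g p.1 p.2 ^ 2 + 4 * (∫ u, g p.1 u ∂ν) ^ 2 +
        4 * (∫ u, g u p.2 ∂ν) ^ 2 + 4 * c ^ 2) ∂(ν.prod ν) := by
    refine integral_mono hmem.integrable_sq ((((hg.integrable_sq.const_mul 4).add
      (hA2.integrable_sq.const_mul 4)).add (hB2.integrable_sq.const_mul 4)).add
      (integrable_const _)) fun p => ?_
    simp only [BTest.centredKernel, ← hc]
    set a := g p.1 p.2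
    set b := ∫ u, g p.1 u ∂ν
    set d := ∫ u, g u p.2 ∂ν
    nlinarith [sq_nonneg (a + b), sq_nonneg (a + d), sq_nonneg (a - c), sq_nonneg (b - d),
      sq_nonneg (b + c), sq_nonneg (d + c)]
  refine hbound.trans ?_
  rw [integral_add (((hg.integrable_sq.const_mul 4).fun_add (hA2.integrable_sq.const_mul 4)).fun_add
    (hB2.integrable_sq.const_mul 4)) (integrable_const _),
    integral_add ((hg.integrable_sq.const_mul 4).fun_add (hA2.integrable_sq.const_mul 4))
    (hB2.integrable_sq.const_mul 4),
    integral_add (hg.integrable_sq.const_mul 4) (hA2.integrable_sq.const_mul 4),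
    integral_const_mul, integral_const_mul, integral_const_mul, hAi, hBi]
  simp only [integral_const, probReal_univ, one_smul]
  linarith

end Centring

section Core

variable {X : Type*} [MeasurableSpace X] {P : Measure X} [IsProbabilityMeasure P]

omit [IsProbabilityMeasure P] in
theorem centredKernel_comm {k : X → X → ℝ} (hk : ∀ x x', k x x' = k x' x) (x x' : X) :
    BTest.centredKernel k P x x' = BTest.centredKernel k P x' x := by
  have h : ∀ x, ∫ u, k u x ∂P = ∫ u, k x u ∂P := fun x => by simp_rw [hk x]
  rw [BTest.centredKernel, BTest.centredKernel, h, h, hk x x']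
  ring

omit [IsProbabilityMeasure P] in
/-- The core does not see the centring: the partial means cancel. -/
theorem core_centredKernel {k : X → X → ℝ} (hk : ∀ x x', k x x' = k x' x) (z z' : X × X) :
    BTest.core (BTest.centredKernel k P) z z' = BTest.core k z z' := by
  have h : ∀ x, ∫ u, k u x ∂P = ∫ u, k x u ∂P := fun x => by simp_rw [hk x]
  simp only [BTest.core, BTest.centredKernel, h]
  ring

omit [MeasurableSpace X] in
theorem core_comm {k : X → X → ℝ} (hk : ∀ x x', k x x' = k x' x) (z z' : X × X) :
    BTest.core k z z' = BTest.core k z' z := by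
  simp only [BTest.core]
  rw [hk z.1 z'.1, hk z.2 z'.2]
  ring

/-- The centred kernel is square integrable as soon as the core is: integrating the core over the
second component of each point leaves the centred kernel. -/
theorem memLp_two_centredKernel_of_core {k : X → X → ℝ} (hk : ∀ x x', k x x' = k x' x)
    (hkP : Integrable (fun p : X × X => k p.1 p.2) (P.prod P))
    (hh : MemLp (fun w : (X × X) × (X × X) => BTest.core k w.1 w.2) 2
      ((P.prod P).prod (P.prod P))) :
    MemLp (fun p : X × X => BTest.centredKernel k P p.1 p.2) 2 (P.prod P) := by
  -- write `z = (x, y)`, `z' = (x', y')`: integrate `y'` out, move `y` last, integrate `y` out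
  have h1 : MemLp (fun v : ((X × X) × X) × X => BTest.core k v.1.1 (v.1.2, v.2)) 2
      (((P.prod P).prod P).prod P) :=
    hh.comp_measurePreserving (measurePreserving_prodAssoc (P.prod P) P P)
  have h2 : MemLp (fun v : (X × X) × X => ∫ y', BTest.core k v.1 (v.2, y') ∂P) 2
      ((P.prod P).prod P) := memLp_two_integral_prod_right h1
  have h3 : MemLp (fun v : X × (X × X) => ∫ y', BTest.core k v.2 (v.1, y') ∂P) 2
      (P.prod (P.prod P)) := h2.comp_measurePreserving Measure.measurePreserving_swap
  have h4 : MemLp (fun v : (X × X) × X => ∫ y', BTest.core k (v.1.2, v.2) (v.1.1, y') ∂P) 2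
      ((P.prod P).prod P) := h3.comp_measurePreserving (measurePreserving_prodAssoc P P P)
  have h5 : MemLp (fun p : X × X => ∫ y, ∫ y', BTest.core k (p.2, y) (p.1, y') ∂P ∂P) 2
      (P.prod P) := memLp_two_integral_prod_right h4
  refine h5.ae_eq ?_
  have hsec : ∀ᵐ x ∂P, Integrable (fun y => k x y) P := hkP.prod_right_ae
  have hm : Integrable (fun x => ∫ u, k x u ∂P) P := hkP.integral_prod_left
  filter_upwards [Measure.quasiMeasurePreserving_fst.ae hsec,
    Measure.quasiMeasurePreserving_snd.ae hsec] with p hp1 hp2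
  have h6 : ∀ᵐ y ∂P, ∫ y', BTest.core k (p.2, y) (p.1, y') ∂P =
      k p.2 p.1 + (∫ u, k y u ∂P) - (∫ u, k p.2 u ∂P) - k p.1 y := by
    filter_upwards [hsec] with y hy
    simp only [BTest.core]
    rw [integral_sub (((integrable_const _).fun_add hy).fun_sub hp2) (integrable_const _),
      integral_sub ((integrable_const _).fun_add hy) hp2, integral_add (integrable_const _) hy]
    simp
  rw [integral_congr_ae h6,
    integral_sub (((integrable_const _).fun_add hm).fun_sub (integrable_const _)) hp1,
    integral_sub ((integrable_const _).fun_add hm) (integrable_const _),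
    integral_add (integrable_const _) hm]
  have h : ∀ x, ∫ u, k u x ∂P = ∫ u, k x u ∂P := fun x => by simp_rw [hk x]
  simp only [BTest.centredKernel, integral_const, probReal_univ, one_smul, h, hk p.2 p.1]
  ring

theorem isDegenerate_core {κ : X → X → ℝ} (hκ : ∀ x x', κ x x' = κ x' x)
    (hL : MemLp (fun p : X × X => κ p.1 p.2) 2 (P.prod P)) (hdeg : IsDegenerate κ P) :
    IsDegenerate (BTest.core κ) (P.prod P) := by
  have hright : ∀ᵐ z ∂(P.prod P), ∫ z', BTest.core κ z z' ∂(P.prod P) = 0 := by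
    have hsec : ∀ᵐ x ∂P, Integrable (fun y => κ x y) P :=
      (hL.integrable (by norm_num)).prod_right_ae
    filter_upwards [Measure.quasiMeasurePreserving_fst.ae hdeg.1,
      Measure.quasiMeasurePreserving_snd.ae hdeg.1, Measure.quasiMeasurePreserving_fst.ae hsec,
      Measure.quasiMeasurePreserving_snd.ae hsec] with z h1 h2 h3 h4
    simp only [BTest.core, hκ _ z.2]
    rw [integral_sub (((h3.comp_fst P).fun_add (h4.comp_snd P)).fun_sub (h3.comp_snd P))
        (h4.comp_fst P),
      integral_sub ((h3.comp_fst P).fun_add (h4.comp_snd P)) (h3.comp_snd P),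
      integral_add (h3.comp_fst P) (h4.comp_snd P),
      integral_fun_fst (f := fun y => κ z.1 y), integral_fun_snd (f := fun y => κ z.2 y),
      integral_fun_snd (f := fun y => κ z.1 y), integral_fun_fst (f := fun y => κ z.2 y), h1, h2]
    simp
  refine ⟨hright, ?_⟩
  simpa only [core_comm hκ] using hright

/-- The four terms of the core of a degenerate kernel are orthogonal in `L²`. -/
theorem integral_core_sq {κ : X → X → ℝ} (hκ : ∀ x x', κ x x' = κ x' x)
    (hL : MemLp (fun p : X × X => κ p.1 p.2) 2 (P.prod P)) (hdeg : IsDegenerate κ P) :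
    ∫ w, BTest.core κ w.1 w.2 ^ 2 ∂((P.prod P).prod (P.prod P)) =
      4 * ∫ p, κ p.1 p.2 ^ 2 ∂(P.prod P) := by
  set ν := P.prod P with hν
  have mfst : MeasurePreserving (Prod.fst : X × X → X) ν P := measurePreserving_fst
  have msnd : MeasurePreserving (Prod.snd : X × X → X) ν P := measurePreserving_snd
  have hz : ∀ᵐ z ∂ν, (∫ u, κ z.1 u ∂P = 0) ∧ ∫ u, κ z.2 u ∂P = 0 := by
    filter_upwards [mfst.quasiMeasurePreserving.ae hdeg.1,
      msnd.quasiMeasurePreserving.ae hdeg.1] with z h1 h2 using ⟨h1, h2⟩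
  -- after conditioning on one of the two points, a product of two terms integrates to `0`
  have hcross {F G : X × X → X → ℝ} {a b : (X × X) × (X × X) → ℝ}
      (ha : MemLp a 2 (ν.prod ν)) (hb : MemLp b 2 (ν.prod ν))
      (hF : ∀ᵐ z ∂ν, ∫ u, F z u ∂P = 0)
      (hab : (∀ z z', a (z, z') * b (z, z') = F z z'.1 * G z z'.2) ∨
        ∀ z z', a (z, z') * b (z, z') = F z' z.1 * G z' z.2) :
      ∫ w, a w * b w ∂(ν.prod ν) = 0 := by
    have hint : Integrable (fun w => a w * b w) (ν.prod ν) := ha.integrable_mul hb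
    rcases hab with hab | hab
    · rw [integral_prod _ hint]
      refine integral_eq_zero_of_ae ?_
      filter_upwards [hF] with z hz
      simp only [hab]
      rw [integral_prod_mul (F z) (G z), hz, zero_mul, Pi.zero_apply]
    · rw [integral_prod_symm _ hint]
      refine integral_eq_zero_of_ae ?_
      filter_upwards [hF] with z hz
      simp only [hab]
      rw [integral_prod_mul (F z) (G z), hz, zero_mul, Pi.zero_apply]
  have mA := mfst.prod mfst
  have mB := msnd.prod msnd
  have mC := mfst.prod msnd
  have mD := msnd.prod mfst
  have hA : MemLp (fun w : (X × X) × (X × X) => κ w.1.1 w.2.1) 2 (ν.prod ν) :=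
    hL.comp_measurePreserving mA
  have hB : MemLp (fun w : (X × X) × (X × X) => κ w.1.2 w.2.2) 2 (ν.prod ν) :=
    hL.comp_measurePreserving mB
  have hC : MemLp (fun w : (X × X) × (X × X) => κ w.1.1 w.2.2) 2 (ν.prod ν) :=
    hL.comp_measurePreserving mC
  have hD : MemLp (fun w : (X × X) × (X × X) => κ w.1.2 w.2.1) 2 (ν.prod ν) :=
    hL.comp_measurePreserving mD
  have hsq {T : (X × X) × (X × X) → X × X} (hT : MeasurePreserving T (ν.prod ν) (P.prod P)) :
      ∫ w, κ (T w).1 (T w).2 ^ 2 ∂(ν.prod ν) = ∫ p, κ p.1 p.2 ^ 2 ∂(P.prod P) := by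
    have := integral_map (f := fun p : X × X => κ p.1 p.2 ^ 2) hT.measurable.aemeasurable
      (by rw [hT.map_eq]; exact hL.integrable_sq.1)
    rw [hT.map_eq] at this
    exact this.symm
  have sA := hsq mA
  have sB := hsq mB
  have sC := hsq mC
  have sD := hsq mD
  simp only [Prod.map_fst, Prod.map_snd] at sA sB sC sD
  have hAB := hcross (F := fun z u => κ z.1 u) (G := fun z u => κ z.2 u) hA hB
    (hz.mono fun z h => h.1) (Or.inl fun z z' => rfl)
  have hAC := hcross (F := fun z u => κ z.1 u) (G := fun z u => κ z.1 u) hA hC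
    (hz.mono fun z h => h.1) (Or.inl fun z z' => rfl)
  have hAD := hcross (F := fun z u => κ z.1 u) (G := fun z u => κ z.1 u) hA hD
    (hz.mono fun z h => h.1) (Or.inr fun z z' => by simp only [hκ z'.1])
  have hBC := hcross (F := fun z u => κ z.2 u) (G := fun z u => κ z.2 u) hC hB
    (hz.mono fun z h => h.2) (Or.inr fun z z' => by simp only [hκ z'.2])
  have hBD := hcross (F := fun z u => κ z.2 u) (G := fun z u => κ z.2 u) hD hB
    (hz.mono fun z h => h.2) (Or.inl fun z z' => rfl)
  have hCD := hcross (F := fun z u => κ z.2 u) (G := fun z u => κ z.1 u) hD hC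
    (hz.mono fun z h => h.2) (Or.inl fun z z' => rfl)
  have hexp (w : (X × X) × (X × X)) : BTest.core κ w.1 w.2 ^ 2 =
      ((((κ w.1.1 w.2.1 ^ 2 + κ w.1.2 w.2.2 ^ 2) + κ w.1.1 w.2.2 ^ 2) + κ w.1.2 w.2.1 ^ 2) +
      2 * (((κ w.1.1 w.2.1 * κ w.1.2 w.2.2 - κ w.1.1 w.2.1 * κ w.1.1 w.2.2) -
        κ w.1.1 w.2.1 * κ w.1.2 w.2.1) + ((κ w.1.2 w.2.1 * κ w.1.1 w.2.2 -
        κ w.1.1 w.2.2 * κ w.1.2 w.2.2) - κ w.1.2 w.2.1 * κ w.1.2 w.2.2))) := by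
    rw [BTest.core, hκ w.2.1]
    ring
  have iA := hA.integrable_sq
  have iB := hB.integrable_sq
  have iC := hC.integrable_sq
  have iD := hD.integrable_sq
  have iAB : Integrable (fun w : (X × X) × (X × X) => κ w.1.1 w.2.1 * κ w.1.2 w.2.2) (ν.prod ν) :=
    hA.integrable_mul hB
  have iAC : Integrable (fun w : (X × X) × (X × X) => κ w.1.1 w.2.1 * κ w.1.1 w.2.2) (ν.prod ν) :=
    hA.integrable_mul hC
  have iAD : Integrable (fun w : (X × X) × (X × X) => κ w.1.1 w.2.1 * κ w.1.2 w.2.1) (ν.prod ν) :=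
    hA.integrable_mul hD
  have iDC : Integrable (fun w : (X × X) × (X × X) => κ w.1.2 w.2.1 * κ w.1.1 w.2.2) (ν.prod ν) :=
    hD.integrable_mul hC
  have iCB : Integrable (fun w : (X × X) × (X × X) => κ w.1.1 w.2.2 * κ w.1.2 w.2.2) (ν.prod ν) :=
    hC.integrable_mul hB
  have iDB : Integrable (fun w : (X × X) × (X × X) => κ w.1.2 w.2.1 * κ w.1.2 w.2.2) (ν.prod ν) :=
    hD.integrable_mul hB
  simp_rw [hexp]
  rw [integral_add (((iA.fun_add iB).fun_add iC).fun_add iD)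
      ((((iAB.fun_sub iAC).fun_sub iAD).fun_add ((iDC.fun_sub iCB).fun_sub iDB)).const_mul 2),
    integral_add ((iA.fun_add iB).fun_add iC) iD, integral_add (iA.fun_add iB) iC,
    integral_add iA iB,
    integral_const_mul,
    integral_add ((iAB.fun_sub iAC).fun_sub iAD) ((iDC.fun_sub iCB).fun_sub iDB),
    integral_sub (iAB.fun_sub iAC) iAD, integral_sub iAB iAC, integral_sub (iDC.fun_sub iCB) iDB,
    integral_sub iDC iCB, hAB, hAC, hAD, hBC, hBD, hCD, sA, sB, sC, sD]
  ring

end Core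

/-! ### Moments of degenerate sums over pairs -/

section Sample

variable {Ω Z : Type*} [MeasurableSpace Ω] [MeasurableSpace Z]

/-- `z` is a sequence of independent random variables with common law `ν`. -/
structure IsIIDSample (z : ℕ → Ω → Z) (ν : Measure Z) (μ : Measure Ω) : Prop where
  measurable : ∀ a, Measurable (z a)
  indep : iIndepFun z μ
  map_eq : ∀ a, μ.map (z a) = ν

/-- The `σ`-algebra generated by all sample points except the one with index `b`. -/
@[reducible] def others (z : ℕ → Ω → Z) (b : ℕ) : MeasurableSpace Ω :=
  ⨆ a ∈ ({b}ᶜ : Set ℕ), MeasurableSpace.comap (z a) inferInstance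

/-- The sum of the kernel `g` over the first `m` entries of row `b`. -/
def rowSum (g : Z → Z → ℝ) (x : ℕ → Z) (b m : ℕ) : ℝ := ∑ a ∈ Finset.range m, g (x a) (x b)

/-- The sum of the kernel `g` over all pairs `a < b < n`. -/
def pairSum (g : Z → Z → ℝ) (x : ℕ → Z) (n : ℕ) : ℝ := ∑ b ∈ Finset.range n, rowSum g x b b

variable {z : ℕ → Ω → Z} {ν : Measure Z} {μ : Measure Ω} {g : Z → Z → ℝ}

omit [MeasurableSpace Ω] in
theorem measurable_others {a b : ℕ} (hab : a ≠ b) : Measurable[others z b] (z a) := by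
  have h : MeasurableSpace.comap (z a) inferInstance ≤ others z b :=
    le_iSup₂_of_le (f := fun a (_ : a ∈ ({b}ᶜ : Set ℕ)) =>
      MeasurableSpace.comap (z a) inferInstance) a hab le_rfl
  exact Measurable.of_comap_le h

theorem measurable_rowSum (hg : Measurable fun p : Z × Z => g p.1 p.2) {x : ℕ → Ω → Z} {b m : ℕ}
    (hb : Measurable (x b)) (hm : ∀ a < m, Measurable (x a)) :
    Measurable fun ω => rowSum g (fun a => x a ω) b m :=
  Finset.measurable_fun_sum _ fun a ha =>
    hg.comp ((hm a (Finset.mem_range.1 ha)).prodMk hb)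

theorem measurable_pairSum (hg : Measurable fun p : Z × Z => g p.1 p.2) {x : ℕ → Ω → Z} {n : ℕ}
    (hx : ∀ a < n, Measurable (x a)) : Measurable fun ω => pairSum g (fun a => x a ω) n :=
  Finset.measurable_fun_sum _ fun b hb => by
    have hb' := Finset.mem_range.1 hb
    exact measurable_rowSum hg (hx b hb') fun a ha => hx a (ha.trans hb')

omit [MeasurableSpace Ω] in
theorem measurable_rowSum_others (hg : Measurable fun p : Z × Z => g p.1 p.2) {b m c : ℕ}
    (hbc : b ≠ c) (hmc : m ≤ c) :
    Measurable[others z c] fun ω => rowSum g (fun a => z a ω) b m :=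
  @measurable_rowSum Ω Z (others z c) _ _ hg z b m (measurable_others hbc)
    fun a ha => measurable_others (by omega)

omit [MeasurableSpace Ω] in
theorem measurable_pairSum_others (hg : Measurable fun p : Z × Z => g p.1 p.2) (n : ℕ) :
    Measurable[others z n] fun ω => pairSum g (fun a => z a ω) n :=
  @measurable_pairSum Ω Z (others z n) _ _ hg z n fun a ha => measurable_others (by omega)

omit [MeasurableSpace Z] in
theorem pairSum_succ (x : ℕ → Z) (n : ℕ) :
    pairSum g x (n + 1) = pairSum g x n + rowSum g x n n := Finset.sum_range_succ _ _

omit [MeasurableSpace Z] in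
theorem rowSum_succ (x : ℕ → Z) (b m : ℕ) :
    rowSum g x b (m + 1) = rowSum g x b m + g (x m) (x b) := Finset.sum_range_succ _ _

theorem integral_add_sq_of_orthogonal {S D : Ω → ℝ} (hS : MemLp S 2 μ) (hD : MemLp D 2 μ)
    (h : ∫ ω, S ω * D ω ∂μ = 0) :
    ∫ ω, (S ω + D ω) ^ 2 ∂μ = ∫ ω, S ω ^ 2 ∂μ + ∫ ω, D ω ^ 2 ∂μ := by
  have hSD : Integrable (fun ω => S ω * D ω) μ := hS.integrable_mul hD
  have : ∀ ω, (S ω + D ω) ^ 2 = S ω ^ 2 + D ω ^ 2 + 2 * (S ω * D ω) := fun ω => by ring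
  simp_rw [this]
  rw [integral_add (hS.integrable_sq.fun_add hD.integrable_sq) (hSD.const_mul 2),
    integral_add hS.integrable_sq hD.integrable_sq, integral_const_mul, h]
  ring

namespace IsIIDSample

variable [IsProbabilityMeasure ν] [IsProbabilityMeasure μ] (hz : IsIIDSample z ν μ)
include hz

omit [IsProbabilityMeasure ν] [IsProbabilityMeasure μ] in
theorem others_le (b : ℕ) : others z b ≤ (inferInstance : MeasurableSpace Ω) :=
  iSup₂_le fun a _ => (hz.measurable a).comap_le

omit [IsProbabilityMeasure ν] [IsProbabilityMeasure μ] in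
theorem indep_others (b : ℕ) :
    Indep (others z b) (MeasurableSpace.comap (z b) inferInstance) μ := by
  have h := indep_iSup_of_disjoint (m := fun a => MeasurableSpace.comap (z a) inferInstance)
    (fun a => (hz.measurable a).comap_le) ((iIndepFun_iff_iIndep _ _ _).1 hz.indep)
    (S := {b}ᶜ) (T := {b}) disjoint_compl_left
  simpa only [Set.mem_singleton_iff, iSup_iSup_eq_left] using h

omit [IsProbabilityMeasure ν] in
theorem measurePreserving_pair {a b : ℕ} (hab : a ≠ b) :
    MeasurePreserving (fun ω => (z a ω, z b ω)) μ (ν.prod ν) := by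
  refine ⟨(hz.measurable a).prodMk (hz.measurable b), ?_⟩
  rw [(indepFun_iff_map_prod_eq_prod_map_map (hz.measurable a).aemeasurable
    (hz.measurable b).aemeasurable).1 (hz.indep.indepFun hab), hz.map_eq, hz.map_eq]

/-- A degenerate kernel evaluated at a pair is orthogonal to everything that does not involve the
second point of the pair. -/
theorem integral_mul_kernel_eq_zero (hg : Measurable fun p : Z × Z => g p.1 p.2)
    (hdeg : ∀ᵐ x ∂ν, ∫ y, g x y ∂ν = 0) {a b : ℕ} (hab : a ≠ b) {F : Ω → ℝ}
    (hF : Measurable[others z b] F) (hint : Integrable (fun ω => F ω * g (z a ω) (z b ω)) μ) :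
    ∫ ω, F ω * g (z a ω) (z b ω) ∂μ = 0 := by
  -- `W = (F, z a)` is independent of `z b`, so the integral over the law of `z b` can be done first
  set W : Ω → ℝ × Z := fun ω => (F ω, z a ω) with hW
  have hWo : Measurable[others z b] W :=
    Measurable.prodMk (m := others z b) hF (measurable_others hab)
  have hWm : Measurable W := hWo.mono (hz.others_le b) le_rfl
  have hind : IndepFun W (z b) μ :=
    (IndepFun_iff_Indep _ _ _).2 (indep_of_indep_of_le_left (hz.indep_others b) hWo.comap_le)
  have hmap := (indepFun_iff_map_prod_eq_prod_map_map hWm.aemeasurable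
    (hz.measurable b).aemeasurable).1 hind
  rw [hz.map_eq] at hmap
  set Φ : (ℝ × Z) × Z → ℝ := fun p => p.1.1 * g p.1.2 p.2 with hΦ
  have hΦm : Measurable Φ :=
    measurable_fst.fst.mul (hg.comp (measurable_fst.snd.prodMk measurable_snd))
  have hWb : Measurable fun ω => (W ω, z b ω) := hWm.prodMk (hz.measurable b)
  have h1 : ∫ ω, F ω * g (z a ω) (z b ω) ∂μ = ∫ p, Φ p ∂((μ.map W).prod ν) := by
    rw [← hmap, integral_map hWb.aemeasurable hΦm.aestronglyMeasurable]
  have hprob : IsProbabilityMeasure (μ.map W) := Measure.isProbabilityMeasure_map hWm.aemeasurable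
  have h2 : Integrable Φ ((μ.map W).prod ν) := by
    rw [← hmap, integrable_map_measure hΦm.aestronglyMeasurable hWb.aemeasurable]
    exact hint
  rw [h1, integral_prod _ h2]
  refine integral_eq_zero_of_ae ?_
  have hsnd : (μ.map W).map Prod.snd = ν := by
    rw [Measure.map_map measurable_snd hWm, ← hz.map_eq a]
    rfl
  have hdeg' : ∀ᵐ x ∂((μ.map W).map Prod.snd), ∫ y, g x y ∂ν = 0 := by rwa [hsnd]
  have h3 := ae_of_ae_map measurable_snd.aemeasurable hdeg'
  filter_upwards [h3] with w hw
  simp only [hΦ]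
  rw [integral_const_mul, hw, mul_zero, Pi.zero_apply]

/-- The mirror image of `integral_mul_kernel_eq_zero`: orthogonality to everything that does not
involve the first point of the pair. -/
theorem integral_mul_kernel_eq_zero' (hg : Measurable fun p : Z × Z => g p.1 p.2)
    (hdeg : ∀ᵐ y ∂ν, ∫ x, g x y ∂ν = 0) {a b : ℕ} (hab : a ≠ b) {F : Ω → ℝ}
    (hF : Measurable[others z a] F) (hint : Integrable (fun ω => F ω * g (z a ω) (z b ω)) μ) :
    ∫ ω, F ω * g (z a ω) (z b ω) ∂μ = 0 :=
  hz.integral_mul_kernel_eq_zero (g := fun x y => g y x) (hg.comp measurable_swap) hdeg hab.symm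
    hF hint

section SecondMoment

variable (hg : Measurable fun p : Z × Z => g p.1 p.2) (hdeg : IsDegenerate g ν)
  (hL : MemLp (fun p : Z × Z => g p.1 p.2) 2 (ν.prod ν))
include hL

omit [IsProbabilityMeasure ν] in
theorem memLp_kernel {a b : ℕ} (hab : a ≠ b) : MemLp (fun ω => g (z a ω) (z b ω)) 2 μ :=
  hL.comp_measurePreserving (hz.measurePreserving_pair hab)

omit [IsProbabilityMeasure ν] in
theorem memLp_rowSum {b m : ℕ} (hmb : m ≤ b) :
    MemLp (fun ω => rowSum g (fun a => z a ω) b m) 2 μ :=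
  memLp_finsetSum _ fun a ha => hz.memLp_kernel hL (by have := Finset.mem_range.1 ha; omega)

omit [IsProbabilityMeasure ν] in
theorem memLp_pairSum (n : ℕ) : MemLp (fun ω => pairSum g (fun a => z a ω) n) 2 μ :=
  memLp_finsetSum _ fun _ _ => hz.memLp_rowSum hL le_rfl

omit [IsProbabilityMeasure ν] in
theorem integral_kernel_sq {a b : ℕ} (hab : a ≠ b) :
    ∫ ω, g (z a ω) (z b ω) ^ 2 ∂μ = ∫ p, g p.1 p.2 ^ 2 ∂(ν.prod ν) := by
  have hT := hz.measurePreserving_pair hab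
  have := integral_map (f := fun p : Z × Z => g p.1 p.2 ^ 2) hT.measurable.aemeasurable
    (by rw [hT.map_eq]; exact hL.integrable_sq.1)
  rw [hT.map_eq] at this
  exact this.symm

include hg hdeg

theorem integral_rowSum_sq {b m : ℕ} (hmb : m ≤ b) :
    ∫ ω, rowSum g (fun a => z a ω) b m ^ 2 ∂μ = m * ∫ p, g p.1 p.2 ^ 2 ∂(ν.prod ν) := by
  induction m with
  | zero => simp [rowSum]
  | succ m ih =>
    have hm : m ≠ b := by omega
    have hR := hz.memLp_rowSum hL (m := m) (b := b) (by omega)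
    simp_rw [rowSum_succ]
    rw [integral_add_sq_of_orthogonal hR (hz.memLp_kernel hL hm), ih (by omega),
      hz.integral_kernel_sq hL hm]
    · push_cast; ring
    · exact hz.integral_mul_kernel_eq_zero' hg hdeg.2 hm
        (measurable_rowSum_others hg hm.symm le_rfl) (hR.integrable_mul (hz.memLp_kernel hL hm))

omit hL in
theorem integral_mul_rowSum_eq_zero {n : ℕ} {F : Ω → ℝ} (hF : Measurable[others z n] F)
    (hint : ∀ a < n, Integrable (fun ω => F ω * g (z a ω) (z n ω)) μ) :
    ∫ ω, F ω * rowSum g (fun a => z a ω) n n ∂μ = 0 := by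
  simp_rw [rowSum, Finset.mul_sum]
  rw [integral_finsetSum _ fun a ha => hint a (Finset.mem_range.1 ha)]
  refine Finset.sum_eq_zero fun a ha => ?_
  have ha' := Finset.mem_range.1 ha
  exact hz.integral_mul_kernel_eq_zero hg hdeg.1 (by omega) hF (hint a ha')

/-- The rows of the sum over pairs are orthogonal, as are the entries of each row. -/
theorem integral_pairSum_sq (n : ℕ) :
    ∫ ω, pairSum g (fun a => z a ω) n ^ 2 ∂μ =
      (n : ℝ) * (n - 1) / 2 * ∫ p, g p.1 p.2 ^ 2 ∂(ν.prod ν) := by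
  induction n with
  | zero => simp [pairSum]
  | succ n ih =>
    have hS := hz.memLp_pairSum hL n
    simp_rw [pairSum_succ]
    rw [integral_add_sq_of_orthogonal hS (hz.memLp_rowSum hL le_rfl), ih,
      hz.integral_rowSum_sq hg hdeg hL le_rfl]
    · push_cast; ring
    · refine hz.integral_mul_rowSum_eq_zero hg hdeg (measurable_pairSum_others hg n) fun a ha => ?_
      exact hS.integrable_mul (hz.memLp_kernel hL (by omega))

theorem integral_pairSum (n : ℕ) : ∫ ω, pairSum g (fun a => z a ω) n ∂μ = 0 := by
  induction n with
  | zero => simp [pairSum]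
  | succ n ih =>
    simp_rw [pairSum_succ]
    rw [integral_add ((hz.memLp_pairSum hL n).integrable (by norm_num))
      ((hz.memLp_rowSum hL le_rfl).integrable (by norm_num)), ih, zero_add]
    have := hz.integral_mul_rowSum_eq_zero hg hdeg (n := n) (F := fun _ => 1)
      (@measurable_const _ _ _ (others z n) _) fun a ha => by
        simpa using (hz.memLp_kernel hL (a := a) (b := n) (by omega)).integrable (by norm_num)
    simpa using this

end SecondMoment

end IsIIDSample

section FourthMoment

/-- A bounded measurable random variable. -/
structure IsBoundedVar (f : Ω → ℝ) : Prop where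
  measurable : Measurable f
  bounded : ∃ C, ∀ ω, |f ω| ≤ C

namespace IsBoundedVar

variable {f f' : Ω → ℝ}

theorem add (hf : IsBoundedVar f) (hf' : IsBoundedVar f') : IsBoundedVar fun ω => f ω + f' ω := by
  obtain ⟨C, hC⟩ := hf.2
  obtain ⟨C', hC'⟩ := hf'.2
  exact ⟨hf.1.add hf'.1, C + C', fun ω => (abs_add_le _ _).trans (add_le_add (hC ω) (hC' ω))⟩

theorem mul (hf : IsBoundedVar f) (hf' : IsBoundedVar f') : IsBoundedVar fun ω => f ω * f' ω := by
  obtain ⟨C, hC⟩ := hf.2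
  obtain ⟨C', hC'⟩ := hf'.2
  refine ⟨hf.1.mul hf'.1, C * C', fun ω => ?_⟩
  rw [abs_mul]
  exact mul_le_mul (hC ω) (hC' ω) (abs_nonneg _) ((abs_nonneg _).trans (hC ω))

theorem pow (hf : IsBoundedVar f) (n : ℕ) : IsBoundedVar fun ω => f ω ^ n := by
  obtain ⟨C, hC⟩ := hf.2
  refine ⟨hf.1.pow_const n, C ^ n, fun ω => ?_⟩
  rw [abs_pow]
  exact pow_le_pow_left₀ (abs_nonneg _) (hC ω) n

theorem sum {ι : Type*} {s : Finset ι} {F : ι → Ω → ℝ} (hF : ∀ i ∈ s, IsBoundedVar (F i)) :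
    IsBoundedVar fun ω => ∑ i ∈ s, F i ω := by
  classical
  induction s using Finset.induction_on with
  | empty => exact ⟨by simp, 0, by simp⟩
  | insert i s his ih =>
    simp_rw [Finset.sum_insert his]
    exact (hF i (by simp)).add (ih fun j hj => hF j (by simp [hj]))

theorem integrable [IsFiniteMeasure μ] (hf : IsBoundedVar f) : Integrable f μ := by
  obtain ⟨C, hC⟩ := hf.2
  exact Integrable.of_bound hf.1.aestronglyMeasurable C (ae_of_all _ hC)

end IsBoundedVar

/-- Adding an increment `D` with `E S³D = 0` to `S`. The weight `t` balances the mixed term `S²D²`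
between the two fourth moments. -/
theorem integral_add_pow_four_le [IsProbabilityMeasure μ] {S D : Ω → ℝ} (hS : IsBoundedVar S)
    (hD : IsBoundedVar D) (h : ∫ ω, S ω ^ 3 * D ω ∂μ = 0) {t : ℝ} (ht : 0 < t) :
    ∫ ω, (S ω + D ω) ^ 4 ∂μ ≤
      (1 + 2 / t) * ∫ ω, S ω ^ 4 ∂μ + (3 + 8 * t) * ∫ ω, D ω ^ 4 ∂μ := by
  have h1 : ∫ ω, (S ω + D ω) ^ 4 ∂μ ≤
      ∫ ω, ((1 + 2 / t) * S ω ^ 4 + (3 + 8 * t) * D ω ^ 4 + 4 * (S ω ^ 3 * D ω)) ∂μ := by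
    refine integral_mono ((hS.add hD).pow 4).integrable
      ((((hS.pow 4).integrable.const_mul _).add ((hD.pow 4).integrable.const_mul _)).add
      (((hS.pow 3).mul hD).integrable.const_mul 4)) fun ω => ?_
    set s := S ω
    set d := D ω
    have h2 : 8 * (s ^ 2 * d ^ 2) ≤ 2 / t * s ^ 4 + 8 * t * d ^ 4 := by
      have h3 : 2 / t * s ^ 4 + 8 * t * d ^ 4 - 8 * (s ^ 2 * d ^ 2) =
          2 / t * (s ^ 2 - 2 * t * d ^ 2) ^ 2 := by
        field_simp
        ring
      have h4 : 0 ≤ 2 / t * (s ^ 2 - 2 * t * d ^ 2) ^ 2 := by positivity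
      linarith
    simp only
    nlinarith [mul_nonneg (sq_nonneg d) (sq_nonneg (s - d))]
  refine h1.trans (le_of_eq ?_)
  rw [integral_add (((hS.pow 4).integrable.const_mul _).fun_add
    ((hD.pow 4).integrable.const_mul _)) (((hS.pow 3).mul hD).integrable.const_mul 4),
    integral_add ((hS.pow 4).integrable.const_mul _) ((hD.pow 4).integrable.const_mul _),
    integral_const_mul, integral_const_mul, integral_const_mul, h]
  ring

namespace IsIIDSample

variable [IsProbabilityMeasure ν] [IsProbabilityMeasure μ] (hz : IsIIDSample z ν μ)
  (hg : Measurable fun p : Z × Z => g p.1 p.2) {M : ℝ} (hM : ∀ x y, |g x y| ≤ M)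
include hz hg hM

omit [IsProbabilityMeasure ν] [IsProbabilityMeasure μ] in
theorem isBoundedVar_kernel (a b : ℕ) : IsBoundedVar fun ω => g (z a ω) (z b ω) :=
  ⟨hg.comp ((hz.measurable a).prodMk (hz.measurable b)), M, fun _ => hM _ _⟩

omit [IsProbabilityMeasure ν] [IsProbabilityMeasure μ] in
theorem isBoundedVar_rowSum (b m : ℕ) : IsBoundedVar fun ω => rowSum g (fun a => z a ω) b m :=
  IsBoundedVar.sum fun _ _ => hz.isBoundedVar_kernel hg hM _ _

omit [IsProbabilityMeasure ν] [IsProbabilityMeasure μ] in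
theorem isBoundedVar_pairSum (n : ℕ) : IsBoundedVar fun ω => pairSum g (fun a => z a ω) n :=
  IsBoundedVar.sum fun _ _ => hz.isBoundedVar_rowSum hg hM _ _

/-- Conditionally on `z b`, a row is a sum of independent centred bounded variables, whence the
quadratic growth of its fourth moment. -/
theorem integral_rowSum_pow_four_le (hdeg : IsDegenerate g ν) {b m : ℕ} (hmb : m ≤ b) :
    ∫ ω, rowSum g (fun a => z a ω) b m ^ 4 ∂μ ≤ 16 * m ^ 2 * M ^ 4 := by
  induction m with
  | zero => simp [rowSum]
  | succ m ih =>
    have hm : m ≠ b := by omega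
    have hR := hz.isBoundedVar_rowSum hg hM b m
    have hT := hz.isBoundedVar_kernel hg hM m b
    have hT4 : ∫ ω, g (z m ω) (z b ω) ^ 4 ∂μ ≤ M ^ 4 := by
      have : ∫ ω, g (z m ω) (z b ω) ^ 4 ∂μ ≤ ∫ _, M ^ 4 ∂μ :=
        integral_mono (hT.pow 4).integrable (integrable_const _) fun ω => by
          simp only
          rw [← Even.pow_abs (by decide)]
          exact pow_le_pow_left₀ (abs_nonneg _) (hM _ _) 4
      simpa using this
    simp_rw [rowSum_succ]
    rcases Nat.eq_zero_or_pos m with rfl | hpos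
    · have : (0 : ℝ) ≤ M ^ 4 := by positivity
      simp only [rowSum, Finset.range_zero, Finset.sum_empty, zero_add]
      norm_num
      linarith
    have hm0 : (0 : ℝ) < m := by exact_mod_cast hpos
    have h := integral_add_pow_four_le (μ := μ) hR hT
      (hz.integral_mul_kernel_eq_zero' hg hdeg.2 hm
        ((measurable_rowSum_others hg hm.symm le_rfl).pow_const 3)
        ((hR.pow 3).mul hT).integrable) (t := 2 * m) (by positivity)
    -- the weight `t = 2 * m` turns the factor `1 + 2 / t` into `(m + 1) / m`, so that `m ^ 2`
    -- grows by `m`, less than the step from `m ^ 2` to `(m + 1) ^ 2`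
    have ih' := ih (by omega)
    refine h.trans ?_
    have h1 : (1 + 2 / (2 * m : ℝ)) * ∫ ω, rowSum g (fun a => z a ω) b m ^ 4 ∂μ ≤
        (1 + 2 / (2 * m : ℝ)) * (16 * m ^ 2 * M ^ 4) := by gcongr
    have h2 : (3 + 8 * (2 * m : ℝ)) * ∫ ω, g (z m ω) (z b ω) ^ 4 ∂μ ≤
        (3 + 8 * (2 * m : ℝ)) * M ^ 4 := by gcongr
    have h3 : (1 + 2 / (2 * m : ℝ)) * (16 * m ^ 2 * M ^ 4) = (16 * m ^ 2 + 16 * m) * M ^ 4 := by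
      field_simp
    have h4 : (0 : ℝ) ≤ M ^ 4 := by positivity
    push_cast
    nlinarith

/-- For a bounded degenerate kernel the fourth moment of the sum over pairs has the order of the
square of the variance. -/
theorem integral_pairSum_pow_four_le (hdeg : IsDegenerate g ν) (n : ℕ) :
    ∫ ω, pairSum g (fun a => z a ω) n ^ 4 ∂μ ≤ 64 * n ^ 4 * M ^ 4 := by
  induction n with
  | zero => simp [pairSum]
  | succ n ih =>
    have hS := hz.isBoundedVar_pairSum hg hM n
    have hD := hz.isBoundedVar_rowSum hg hM n n
    have hD4 := hz.integral_rowSum_pow_four_le hg hM hdeg (le_refl n)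
    have h4 : (0 : ℝ) ≤ M ^ 4 := by positivity
    simp_rw [pairSum_succ]
    rcases Nat.eq_zero_or_pos n with rfl | hpos
    · simp only [pairSum, rowSum, Finset.range_zero, Finset.sum_empty, zero_add]
      norm_num
      linarith
    have hn0 : (0 : ℝ) < n := by exact_mod_cast hpos
    have h := integral_add_pow_four_le (μ := μ) hS hD
      (hz.integral_mul_rowSum_eq_zero hg hdeg ((measurable_pairSum_others hg n).pow_const 3)
        fun a _ => ((hS.pow 3).mul (hz.isBoundedVar_kernel hg hM a n)).integrable)
      (t := n) hn0
    -- with the weight `t = n` the factor `1 + 2 / n` raises `64 * n ^ 4` by `128 * n ^ 3`, and the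
    -- new row adds about `128 * n ^ 3`: together the leading term of `64 * ((n + 1) ^ 4 - n ^ 4)`
    refine h.trans ?_
    have h1 : (1 + 2 / (n : ℝ)) * ∫ ω, pairSum g (fun a => z a ω) n ^ 4 ∂μ ≤
        (1 + 2 / (n : ℝ)) * (64 * n ^ 4 * M ^ 4) := by gcongr
    have h2 : (3 + 8 * (n : ℝ)) * ∫ ω, rowSum g (fun a => z a ω) n n ^ 4 ∂μ ≤
        (3 + 8 * (n : ℝ)) * (16 * n ^ 2 * M ^ 4) := by gcongr
    have h3 : (1 + 2 / (n : ℝ)) * (64 * n ^ 4 * M ^ 4) = (64 * n ^ 4 + 128 * n ^ 3) * M ^ 4 := by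
      field_simp
      ring
    have h5 : (0 : ℝ) ≤ n ^ 2 * M ^ 4 := by positivity
    have h6 : (0 : ℝ) ≤ n * M ^ 4 := by positivity
    push_cast
    nlinarith

end IsIIDSample

end FourthMoment

end Sample

/-! ### Lindeberg's condition and the central limit theorem -/

section Lindeberg

theorem norm_exp_mul_I_sub_taylor_le (x : ℝ) :
    ‖Complex.exp (x * Complex.I) - 1 - x * Complex.I + (x : ℂ) ^ 2 / 2‖ ≤
      4 * min (x ^ 2) (|x| ^ 3) := by
  have hnx : ‖(x * Complex.I : ℂ)‖ = |x| := by simp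
  rcases le_total |x| 1 with hx | hx
  · have h := Complex.exp_bound (x := x * Complex.I) (by rwa [hnx]) (n := 3) (by norm_num)
    rw [hnx] at h
    have hsum : ∑ m ∈ Finset.range 3, (x * Complex.I : ℂ) ^ m / (m.factorial : ℂ) =
        1 + x * Complex.I - (x : ℂ) ^ 2 / 2 := by
      simp [Finset.sum_range_succ, mul_pow, Nat.factorial]
      ring
    rw [hsum] at h
    have hmin : min (x ^ 2) (|x| ^ 3) = |x| ^ 3 := by
      rw [min_eq_right_iff, ← sq_abs]
      exact pow_le_pow_of_le_one (abs_nonneg _) hx (by norm_num)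
    rw [hmin]
    have heq : Complex.exp (x * Complex.I) - 1 - x * Complex.I + (x : ℂ) ^ 2 / 2 =
        Complex.exp (x * Complex.I) - (1 + x * Complex.I - (x : ℂ) ^ 2 / 2) := by ring
    rw [heq]
    refine h.trans ?_
    have h3 : (0 : ℝ) ≤ |x| ^ 3 := by positivity
    norm_num [Nat.factorial]
    linarith
  · have hmin : min (x ^ 2) (|x| ^ 3) = x ^ 2 := by
      rw [min_eq_left_iff, ← sq_abs]
      exact pow_le_pow_right₀ hx (by norm_num)
    rw [hmin]
    have h1 : ‖Complex.exp (x * Complex.I)‖ = 1 := Complex.norm_exp_ofReal_mul_I x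
    have h2 : ‖(x : ℂ) ^ 2 / 2‖ = x ^ 2 / 2 := by
      rw [norm_div, norm_pow, Complex.norm_real, Real.norm_eq_abs, sq_abs]
      norm_num
    calc ‖Complex.exp (x * Complex.I) - 1 - x * Complex.I + (x : ℂ) ^ 2 / 2‖
        ≤ ‖Complex.exp (x * Complex.I)‖ + ‖(1 : ℂ)‖ + ‖(x * Complex.I : ℂ)‖ + ‖(x : ℂ) ^ 2 / 2‖ :=
          (norm_add_le _ _).trans (by
            gcongr
            exact (norm_sub_le _ _).trans (by gcongr; exact norm_sub_le _ _))
      _ = 1 + 1 + |x| + x ^ 2 / 2 := by rw [h1, hnx, h2, norm_one]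
      _ ≤ 4 * x ^ 2 := by nlinarith [sq_abs x]

theorem norm_pow_sub_pow_le {a b : ℂ} (ha : ‖a‖ ≤ 1) (hb : ‖b‖ ≤ 1) (m : ℕ) :
    ‖a ^ m - b ^ m‖ ≤ m * ‖a - b‖ := by
  induction m with
  | zero => simp
  | succ m ih =>
    have h : a ^ (m + 1) - b ^ (m + 1) = a * (a ^ m - b ^ m) + (a - b) * b ^ m := by ring
    rw [h]
    calc ‖a * (a ^ m - b ^ m) + (a - b) * b ^ m‖
        ≤ ‖a‖ * ‖a ^ m - b ^ m‖ + ‖a - b‖ * ‖b‖ ^ m := by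
          refine (norm_add_le _ _).trans ?_
          rw [norm_mul, norm_mul, norm_pow]
      _ ≤ 1 * (m * ‖a - b‖) + ‖a - b‖ * 1 := by
          gcongr
          exact pow_le_one₀ (norm_nonneg _) hb
      _ = ((m + 1 : ℕ) : ℝ) * ‖a - b‖ := by push_cast; ring

variable {Ω : Type*} [MeasurableSpace Ω] {μ : Measure Ω} [IsProbabilityMeasure μ]

theorem min_sq_cube_nonneg {δ : ℝ} (hδ : 0 ≤ δ) (y : ℝ) : 0 ≤ min (y ^ 2) (δ * |y| ^ 3) := by
  positivity

omit [IsProbabilityMeasure μ] in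
theorem integrable_min_sq_cube {Y : Ω → ℝ} (hY : MemLp Y 2 μ) {δ : ℝ} (hδ : 0 ≤ δ) :
    Integrable (fun ω => min (Y ω ^ 2) (δ * |Y ω| ^ 3)) μ := by
  refine hY.integrable_sq.mono' ?_ (ae_of_all _ fun ω => ?_)
  · exact (Continuous.comp_aestronglyMeasurable
      (g := fun y : ℝ => min (y ^ 2) (δ * |y| ^ 3)) (by fun_prop) hY.1)
  · rw [Real.norm_of_nonneg (min_sq_cube_nonneg hδ _)]
    exact min_le_left _ _

/-- Second order expansion of a characteristic function, with a remainder that needs no third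
moment. -/
theorem norm_charFun_sub_le {Y : Ω → ℝ} (hY : MemLp Y 2 μ) (h0 : ∫ ω, Y ω ∂μ = 0) (s : ℝ) :
    ‖charFun (μ.map Y) s - (1 - (s ^ 2 * ∫ ω, Y ω ^ 2 ∂μ : ℝ) / 2)‖ ≤
      4 * ∫ ω, min ((s * Y ω) ^ 2) (|s * Y ω| ^ 3) ∂μ := by
  have hsY : MemLp (fun ω => s * Y ω) 2 μ := hY.const_mul s
  have hexp : Integrable (fun ω => Complex.exp ((s * Y ω : ℝ) * Complex.I)) μ := by
    refine Integrable.of_bound ?_ 1 (ae_of_all _ fun ω => ?_)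
    · exact Continuous.comp_aestronglyMeasurable
        (g := fun y : ℝ => Complex.exp ((y : ℝ) * Complex.I)) (by fun_prop) hsY.1
    · rw [Complex.norm_exp_ofReal_mul_I]
  have h1 : Integrable (fun ω => ((s * Y ω : ℝ) : ℂ) * Complex.I) μ :=
    ((hsY.integrable (by norm_num)).ofReal).mul_const _
  have h2 : Integrable (fun ω => ((s * Y ω : ℝ) : ℂ) ^ 2 / 2) μ := by
    have := (hsY.integrable_sq.ofReal (𝕜 := ℂ)).div_const 2
    simpa using this
  have hchar : charFun (μ.map Y) s = ∫ ω, Complex.exp ((s * Y ω : ℝ) * Complex.I) ∂μ := by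
    rw [charFun_apply_real, integral_map hY.1.aemeasurable (by fun_prop)]
    push_cast
    rfl
  have hi1 : ∫ ω, ((s * Y ω : ℝ) : ℂ) * Complex.I ∂μ = 0 := by
    rw [integral_mul_const, integral_complex_ofReal, integral_const_mul, h0]
    simp
  have hi2 : ∫ ω, ((s * Y ω : ℝ) : ℂ) ^ 2 / 2 ∂μ = ((s ^ 2 * ∫ ω, Y ω ^ 2 ∂μ : ℝ) : ℂ) / 2 := by
    rw [integral_div, ← integral_const_mul, ← integral_complex_ofReal]
    congr 2 with ω
    push_cast
    ring
  have hmain : charFun (μ.map Y) s - (1 - (s ^ 2 * ∫ ω, Y ω ^ 2 ∂μ : ℝ) / 2) =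
      ∫ ω, (Complex.exp ((s * Y ω : ℝ) * Complex.I) - 1 - (s * Y ω : ℝ) * Complex.I +
        ((s * Y ω : ℝ) : ℂ) ^ 2 / 2) ∂μ := by
    rw [integral_add ((hexp.fun_sub (integrable_const 1)).fun_sub h1) h2,
      integral_sub (hexp.fun_sub (integrable_const 1)) h1, integral_sub hexp (integrable_const 1),
      hi1, hi2, hchar]
    simp
    ring
  rw [hmain, ← integral_const_mul]
  refine norm_integral_le_of_norm_le ?_ (ae_of_all _ fun ω => norm_exp_mul_I_sub_taylor_le _)
  simpa using (integrable_min_sq_cube hsY zero_le_one).const_mul 4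

/-- Lindeberg's central limit theorem at the level of characteristic functions, for rows of
independent copies of `Y j`: the quantity `E min (Y², |Y|³ / √m)` plays the role of the Lindeberg
truncated second moment. -/
theorem tendsto_charFun_pow_of_lindeberg {Y : ℕ → Ω → ℝ} {m : ℕ → ℕ} {u : ℕ → ℝ} {t v : ℝ}
    (hm : Tendsto m atTop atTop) (hu : Tendsto u atTop (𝓝 t))
    (hY : ∀ j, MemLp (Y j) 2 μ) (h0 : ∀ j, ∫ ω, Y j ω ∂μ = 0)
    (hv : Tendsto (fun j => ∫ ω, Y j ω ^ 2 ∂μ) atTop (𝓝 v))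
    (hlind : Tendsto (fun j => ∫ ω, min (Y j ω ^ 2) ((√(m j))⁻¹ * |Y j ω| ^ 3) ∂μ) atTop (𝓝 0)) :
    Tendsto (fun j => charFun (μ.map (Y j)) ((√(m j))⁻¹ * u j) ^ m j) atTop
      (𝓝 (Complex.exp (-(t ^ 2 * v : ℝ) / 2))) := by
  set w : ℕ → ℝ := fun j => u j ^ 2 * ∫ ω, Y j ω ^ 2 ∂μ with hw
  have hw_tend : Tendsto w atTop (𝓝 (t ^ 2 * v)) := (hu.pow 2).mul hv
  have hw0 (j) : 0 ≤ w j := mul_nonneg (sq_nonneg _) (integral_nonneg fun _ => sq_nonneg _)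
  have hmR : Tendsto (fun j => (m j : ℝ)) atTop atTop := tendsto_natCast_atTop_atTop.comp hm
  have hexp : Tendsto (fun j => Complex.exp (-(w j : ℝ) / 2)) atTop
      (𝓝 (Complex.exp (-(t ^ 2 * v : ℝ) / 2))) := by
    have hc : Continuous fun x : ℝ => Complex.exp (-(x : ℝ) / 2) := by fun_prop
    exact (hc.tendsto _).comp hw_tend
  obtain ⟨U, hU1, hU⟩ : ∃ U : ℝ, 1 ≤ U ∧ ∀ᶠ j in atTop, |u j| ≤ U := by
    refine ⟨|t| + 1, by linarith [abs_nonneg t], ?_⟩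
    exact (hu.abs.eventually (eventually_lt_nhds (lt_add_one |t|))).mono fun j hj => hj.le
  have hbound : Tendsto (fun j => 4 * U ^ 3 *
      ∫ ω, min (Y j ω ^ 2) ((√(m j))⁻¹ * |Y j ω| ^ 3) ∂μ + (w j / 2) ^ 2 * ((m j : ℝ))⁻¹)
      atTop (𝓝 0) := by
    have h1 := hlind.const_mul (4 * U ^ 3)
    have h2 := ((hw_tend.div_const 2).pow 2).mul hmR.inv_tendsto_atTop
    simpa using h1.add h2
  have hsmall : ∀ᶠ j in atTop, w j / 2 / m j ≤ 1 := by
    have := (hw_tend.div_const 2).mul hmR.inv_tendsto_atTop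
    rw [mul_zero] at this
    exact (this.eventually (eventually_lt_nhds one_pos)).mono fun j hj => by
      simpa [div_eq_mul_inv] using hj.le
  -- compare the `m`-th powers of the characteristic function and of `exp (-y)`, `y = w / (2 * m)`
  refine hexp.congr_dist (squeeze_zero' (Eventually.of_forall fun j => dist_nonneg) ?_ hbound)
  filter_upwards [hU, hm.eventually_gt_atTop 0, hsmall] with j hUj hmj hwj
  have hm0 : (0 : ℝ) < m j := by exact_mod_cast hmj
  set δ : ℝ := (√(m j))⁻¹ with hδ
  have hδ0 : 0 ≤ δ := by positivity
  have hδ2 : δ ^ 2 = (m j : ℝ)⁻¹ := by rw [hδ, inv_pow, Real.sq_sqrt hm0.le]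
  have hprob : IsProbabilityMeasure (μ.map (Y j)) :=
    Measure.isProbabilityMeasure_map (hY j).1.aemeasurable
  set y : ℝ := w j / 2 / m j with hy
  have hy0 : 0 ≤ y := div_nonneg (div_nonneg (hw0 j) (by norm_num)) hm0.le
  have hpow : Complex.exp (-(w j : ℝ) / 2) = Complex.exp (-(y : ℝ)) ^ m j := by
    rw [← Complex.exp_nat_mul]
    congr 1
    have hmc : (m j : ℂ) ≠ 0 := by exact_mod_cast hm0.ne'
    rw [hy]
    push_cast
    field_simp
  rw [dist_comm, dist_eq_norm, hpow]
  have hb1 : ‖Complex.exp (-(y : ℝ))‖ ≤ 1 := by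
    rw [← Complex.ofReal_neg, ← Complex.ofReal_exp, Complex.norm_real,
      Real.norm_of_nonneg (Real.exp_pos _).le]
    exact Real.exp_le_one_iff.2 (by linarith)
  refine (norm_pow_sub_pow_le (norm_charFun_le_one _) hb1 _).trans ?_
  have htaylor := norm_charFun_sub_le (hY j) (h0 j) (δ * u j)
  have hsy : (δ * u j) ^ 2 * ∫ ω, Y j ω ^ 2 ∂μ = 2 * y := by
    rw [mul_pow, hδ2, hy, hw]
    field_simp
  rw [hsy] at htaylor
  have hexpy : ‖((1 : ℂ) - ((2 * y : ℝ) : ℂ) / 2) - Complex.exp (-(y : ℝ))‖ ≤ y ^ 2 := by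
    have h := Real.abs_exp_sub_one_sub_id_le (x := -y)
      (by rw [abs_neg, abs_of_nonneg hy0]; exact hwj)
    have h' : ((1 : ℂ) - ((2 * y : ℝ) : ℂ) / 2) - Complex.exp (-(y : ℝ)) =
        ((-(Real.exp (-y) - 1 - -y) : ℝ) : ℂ) := by
      push_cast
      ring
    rw [h', Complex.norm_real, norm_neg, Real.norm_eq_abs]
    simpa using h
  have hmin : ∫ ω, min ((δ * u j * Y j ω) ^ 2) (|δ * u j * Y j ω| ^ 3) ∂μ ≤
      U ^ 3 * δ ^ 2 * ∫ ω, min (Y j ω ^ 2) (δ * |Y j ω| ^ 3) ∂μ := by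
    rw [← integral_const_mul]
    refine integral_mono ?_ ((integrable_min_sq_cube (hY j) hδ0).const_mul _) fun ω => ?_
    · simpa using integrable_min_sq_cube ((hY j).const_mul (δ * u j)) zero_le_one
    · simp only
      rw [mul_min_of_nonneg _ _ (by positivity)]
      refine min_le_min ?_ ?_
      · rw [mul_pow, mul_pow]
        have h1 : u j ^ 2 ≤ U ^ 3 := by
          rw [← sq_abs]
          calc |u j| ^ 2 ≤ U ^ 2 := by gcongr
            _ ≤ U ^ 3 := pow_le_pow_right₀ hU1 (by norm_num)
        calc δ ^ 2 * u j ^ 2 * Y j ω ^ 2 ≤ δ ^ 2 * U ^ 3 * Y j ω ^ 2 := by gcongr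
          _ = _ := by ring
      · rw [abs_mul, abs_mul, abs_of_nonneg hδ0]
        calc (δ * |u j| * |Y j ω|) ^ 3 ≤ (δ * U * |Y j ω|) ^ 3 := by gcongr
          _ = _ := by ring
  calc (m j : ℝ) * ‖charFun (μ.map (Y j)) (δ * u j) - Complex.exp (-(y : ℝ))‖
      ≤ m j * (4 * (U ^ 3 * δ ^ 2 * ∫ ω, min (Y j ω ^ 2) (δ * |Y j ω| ^ 3) ∂μ) + y ^ 2) := by
        gcongr
        refine (norm_sub_le_norm_sub_add_norm_sub _
          ((1 : ℂ) - ((2 * y : ℝ) : ℂ) / 2) _).trans (add_le_add (htaylor.trans ?_) hexpy)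
        gcongr
    _ = _ := by
        rw [hδ2, hy]
        field_simp

end Lindeberg

section Truncation

variable {Z : Type*} [MeasurableSpace Z] {ν : Measure Z} [IsProbabilityMeasure ν]

/-- A square integrable degenerate kernel can be approximated in `L²` by bounded degenerate kernels:
truncate, then centre. -/
theorem exists_bounded_isDegenerate_approx {g : Z → Z → ℝ}
    (hg : Measurable fun p : Z × Z => g p.1 p.2) (hdeg : IsDegenerate g ν)
    (hL : MemLp (fun p : Z × Z => g p.1 p.2) 2 (ν.prod ν)) {ε : ℝ} (hε : 0 < ε) :
    ∃ (g' : Z → Z → ℝ) (M : ℝ), (Measurable fun p : Z × Z => g' p.1 p.2) ∧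
      (∀ x y, |g' x y| ≤ M) ∧ IsDegenerate g' ν ∧
      MemLp (fun p : Z × Z => g' p.1 p.2) 2 (ν.prod ν) ∧
      ∫ p, (g p.1 p.2 - g' p.1 p.2) ^ 2 ∂(ν.prod ν) ≤ ε := by
  classical
  set f : ℕ → Z → Z → ℝ := fun N x y => if |g x y| ≤ N then g x y else 0 with hf
  have hfm (N) : Measurable fun p : Z × Z => f N p.1 p.2 :=
    Measurable.ite (measurableSet_le (by fun_prop) measurable_const) hg measurable_const
  have hfN (N x y) : |f N x y| ≤ N := by
    simp only [hf]
    split_ifs with h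
    · exact h
    · simp
  have hfL (N) : MemLp (fun p : Z × Z => f N p.1 p.2) 2 (ν.prod ν) :=
    MemLp.of_bound (hfm N).aestronglyMeasurable N (ae_of_all _ fun p => hfN N _ _)
  have htend : Tendsto (fun N => ∫ p, (g p.1 p.2 - f N p.1 p.2) ^ 2 ∂(ν.prod ν)) atTop (𝓝 0) := by
    have h0 : (0 : ℝ) = ∫ p : Z × Z, (0 : ℝ) ∂(ν.prod ν) := by simp
    rw [h0]
    refine tendsto_integral_of_dominated_convergence (fun p => g p.1 p.2 ^ 2)
      (fun N => ((hg.sub (hfm N)).pow_const 2).aestronglyMeasurable) hL.integrable_sq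
      (fun N => ae_of_all _ fun p => ?_) (ae_of_all _ fun p => ?_)
    · simp only [hf]
      split_ifs
      · simp [sq_nonneg]
      · simp
    · refine tendsto_const_nhds.congr' ?_
      filter_upwards [eventually_ge_atTop ⌈|g p.1 p.2|⌉₊] with N hN
      have : |g p.1 p.2| ≤ N := (Nat.le_ceil _).trans (by exact_mod_cast hN)
      simp [hf, this]
  -- centring costs a factor `16`
  obtain ⟨N, hN⟩ :=
    (htend.eventually (eventually_lt_nhds (show (0 : ℝ) < ε / 16 by positivity))).exists
  have hfi : Integrable (fun p : Z × Z => f N p.1 p.2) (ν.prod ν) :=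
    (hfL N).integrable (by norm_num)
  have hgi : Integrable (fun p : Z × Z => g p.1 p.2) (ν.prod ν) := hL.integrable (by norm_num)
  have habs (h : Z → ℝ) (hb : ∀ x, |h x| ≤ N) : |∫ x, h x ∂ν| ≤ N := by
    have := norm_integral_le_of_norm_le_const (μ := ν) (f := h) (C := N) (ae_of_all _ hb)
    simpa using this
  refine ⟨BTest.centredKernel (f N) ν, 4 * N, ?_, fun x y => ?_,
    isDegenerate_centredKernel hfi, (memLp_two_centredKernel (hfL N)).1, ?_⟩
  · have h1 : Measurable fun x => ∫ u, f N x u ∂ν :=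
      ((hfm N).stronglyMeasurable.integral_prod_right'
        (f := fun p : Z × Z => f N p.1 p.2)).measurable
    have h2 : Measurable fun y => ∫ u, f N u y ∂ν :=
      ((hfm N).stronglyMeasurable.integral_prod_left'
        (f := fun p : Z × Z => f N p.1 p.2)).measurable
    exact (((hfm N).sub (h1.comp measurable_fst)).sub (h2.comp measurable_snd)).add measurable_const
  · have h1 := abs_le.1 (hfN N x y)
    have h2 := abs_le.1 (habs (fun u => f N x u) fun u => hfN N _ _)
    have h3 := abs_le.1 (habs (fun u => f N u y) fun u => hfN N _ _)
    have h4 := abs_le.1 (habs (fun u => ∫ u', f N u u' ∂ν) fun u => habs _ fun u' => hfN N _ _)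
    rw [BTest.centredKernel, abs_le]
    constructor <;> linarith
  · -- centring does not change `g`, so the error is the centred version of `g - f N`
    have h1 := (memLp_two_centredKernel (g := fun x y => g x y - f N x y) (hL.sub (hfL N))).2
    have h2 : ∫ p, (g p.1 p.2 - BTest.centredKernel (f N) ν p.1 p.2) ^ 2 ∂(ν.prod ν) =
        ∫ p, BTest.centredKernel (fun x y => g x y - f N x y) ν p.1 p.2 ^ 2 ∂(ν.prod ν) := by
      refine integral_congr_ae ?_
      filter_upwards [centredKernel_sub_ae_eq hgi hfi, centredKernel_ae_eq_of_isDegenerate hdeg]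
        with p hp hp'
      rw [hp, hp']
    rw [h2]
    linarith

end Truncation

section BlockLindeberg

variable {Ω Z : Type*} [MeasurableSpace Ω] [MeasurableSpace Z] {z : ℕ → Ω → Z} {ν : Measure Z}
  {μ : Measure Ω} [IsProbabilityMeasure ν] [IsProbabilityMeasure μ] {g : Z → Z → ℝ}

/-- The bound by which the Lindeberg quantity of a sum is controlled by a fourth moment of one
summand and a second moment of the other: the larger of the two decides which half of the minimum
to use. -/
theorem min_sq_cube_add_le {δ : ℝ} (hδ : 0 ≤ δ) (a r : ℝ) :
    min ((a + r) ^ 2) (δ * |a + r| ^ 3) ≤ 8 * δ * (1 + a ^ 4) + 4 * r ^ 2 := by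
  have h3 : |a| ^ 3 ≤ 1 + a ^ 4 := by
    have h4 : a ^ 4 = |a| ^ 4 := by rw [Even.pow_abs (by decide)]
    rw [h4]
    rcases le_total |a| 1 with h | h
    · have := pow_le_one₀ (abs_nonneg a) h (n := 3)
      have : 0 ≤ |a| ^ 4 := by positivity
      linarith
    · have := pow_le_pow_right₀ h (show 3 ≤ 4 by norm_num)
      linarith
  rcases le_total |r| |a| with h | h
  · refine (min_le_right _ _).trans ?_
    have h1 : |a + r| ≤ 2 * |a| := (abs_add_le _ _).trans (by linarith)
    calc δ * |a + r| ^ 3 ≤ δ * (2 * |a|) ^ 3 := by gcongr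
      _ = 8 * δ * |a| ^ 3 := by ring
      _ ≤ 8 * δ * (1 + a ^ 4) := by gcongr
      _ ≤ _ := by linarith [sq_nonneg r]
  · refine (min_le_left _ _).trans ?_
    have h1 : |a + r| ≤ 2 * |r| := (abs_add_le _ _).trans (by linarith)
    calc (a + r) ^ 2 = |a + r| ^ 2 := (sq_abs _).symm
      _ ≤ (2 * |r|) ^ 2 := by gcongr
      _ = 4 * r ^ 2 := by rw [mul_pow, sq_abs]; ring
      _ ≤ _ := by
        have : 0 ≤ 8 * δ * (1 + a ^ 4) := by positivity
        linarith

/-- The normalized sum over pairs `2 / (B - 1) * ∑_{a < b < B} g (z a) (z b)`, that is, `B` times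
the U-statistic with kernel `g`. -/
noncomputable def scaledPairSum (g : Z → Z → ℝ) (x : ℕ → Z) (B : ℕ) : ℝ :=
  2 / ((B : ℝ) - 1) * pairSum g x B

namespace IsIIDSample

variable (hz : IsIIDSample z ν μ) (hg : Measurable fun p : Z × Z => g p.1 p.2)
  (hdeg : IsDegenerate g ν) (hL : MemLp (fun p : Z × Z => g p.1 p.2) 2 (ν.prod ν))
include hz hg hdeg hL

omit [IsProbabilityMeasure ν] hg hdeg in
theorem memLp_scaledPairSum (B : ℕ) :
    MemLp (fun ω => scaledPairSum g (fun a => z a ω) B) 2 μ :=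
  (hz.memLp_pairSum hL B).const_mul _

theorem integral_scaledPairSum (B : ℕ) :
    ∫ ω, scaledPairSum g (fun a => z a ω) B ∂μ = 0 := by
  simp_rw [scaledPairSum]
  rw [integral_const_mul, hz.integral_pairSum hg hdeg hL, mul_zero]

theorem integral_scaledPairSum_sq {B : ℕ} (hB : 2 ≤ B) :
    ∫ ω, scaledPairSum g (fun a => z a ω) B ^ 2 ∂μ =
      2 * (B / ((B : ℝ) - 1)) * ∫ p, g p.1 p.2 ^ 2 ∂(ν.prod ν) := by
  have hB' : (2 : ℝ) ≤ B := by exact_mod_cast hB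
  have h1 : (B : ℝ) - 1 ≠ 0 := by linarith
  simp_rw [scaledPairSum, mul_pow]
  rw [integral_const_mul, hz.integral_pairSum_sq hg hdeg hL]
  field_simp

theorem tendsto_integral_scaledPairSum_sq :
    Tendsto (fun B => ∫ ω, scaledPairSum g (fun a => z a ω) B ^ 2 ∂μ) atTop
      (𝓝 (2 * ∫ p, g p.1 p.2 ^ 2 ∂(ν.prod ν))) := by
  have h : Tendsto (fun B : ℕ => (B : ℝ) / ((B : ℝ) - 1)) atTop (𝓝 1) := by
    have := (tendsto_natCast_div_add_atTop (𝕜 := ℝ) (-1))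
    simpa [sub_eq_add_neg] using this
  have h2 := (h.const_mul 2).mul_const (∫ p, g p.1 p.2 ^ 2 ∂(ν.prod ν))
  rw [mul_one] at h2
  refine h2.congr' ?_
  filter_upwards [eventually_ge_atTop 2] with B hB
  rw [hz.integral_scaledPairSum_sq hg hdeg hL hB]

/-- The Lindeberg condition for the block statistics. The kernel is split into a bounded degenerate
part, whose statistic has bounded fourth moments, and a part that is small in `L²`. -/
theorem tendsto_lindeberg_scaledPairSum {B : ℕ → ℕ} {δ : ℕ → ℝ} (hB : Tendsto B atTop atTop)
    (hδ0 : ∀ j, 0 ≤ δ j) (hδ : Tendsto δ atTop (𝓝 0)) :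
    Tendsto (fun j => ∫ ω, min (scaledPairSum g (fun a => z a ω) (B j) ^ 2)
      (δ j * |scaledPairSum g (fun a => z a ω) (B j)| ^ 3) ∂μ) atTop (𝓝 0) := by
  rw [Metric.tendsto_atTop']
  suffices ∀ ε > 0, ∀ᶠ j in atTop, ∫ ω, min (scaledPairSum g (fun a => z a ω) (B j) ^ 2)
      (δ j * |scaledPairSum g (fun a => z a ω) (B j)| ^ 3) ∂μ < ε by
    intro ε hε
    obtain ⟨N, hN⟩ := eventually_atTop.1 (this ε hε)
    refine ⟨N, fun j hj => ?_⟩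
    rw [Real.dist_eq, sub_zero,
      abs_of_nonneg (integral_nonneg fun ω => min_sq_cube_nonneg (hδ0 j) _)]
    exact hN j hj.le
  intro ε hε
  obtain ⟨g', M, hg', hM, hdeg', hL', hclose⟩ :=
    exists_bounded_isDegenerate_approx hg hdeg hL (show 0 < ε / 32 by positivity)
  have hsubm : Measurable fun p : Z × Z => (fun x y => g x y - g' x y) p.1 p.2 := hg.sub hg'
  have hsubL : MemLp (fun p : Z × Z => (fun x y => g x y - g' x y) p.1 p.2) 2 (ν.prod ν) :=
    hL.sub hL'
  have hsubdeg : IsDegenerate (fun x y => g x y - g' x y) ν := by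
    have hi := hL.integrable (q := 2) (by norm_num)
    have hi' := hL'.integrable (q := 2) (by norm_num)
    constructor
    · filter_upwards [hi.prod_right_ae, hi'.prod_right_ae, hdeg.1, hdeg'.1] with x h1 h2 h3 h4
      rw [integral_sub h1 h2, h3, h4, sub_zero]
    · filter_upwards [hi.prod_left_ae, hi'.prod_left_ae, hdeg.2, hdeg'.2] with x h1 h2 h3 h4
      rw [integral_sub h1 h2, h3, h4, sub_zero]
  -- a bound for the fourth moment of the statistic of `g'`, uniform in the block size: the factor
  -- `(2 / (B - 1)) ^ 4` is at most `16 * (2 / B) ^ 4`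
  set K : ℝ := 16 * (64 * 16 * M ^ 4) with hK
  have hlim : Tendsto (fun j => 8 * δ j * (1 + K) + ε / 2) atTop (𝓝 (ε / 2)) := by
    have := ((hδ.const_mul 8).mul_const (1 + K)).add_const (ε / 2)
    simpa using this
  filter_upwards [hlim.eventually (eventually_lt_nhds (half_lt_self hε)), hB.eventually_ge_atTop 2]
    with j hj hBj
  refine lt_of_le_of_lt ?_ hj
  have hB' : (2 : ℝ) ≤ B j := by exact_mod_cast hBj
  have hB1 : (0 : ℝ) < (B j : ℝ) - 1 := by linarith
  -- the bounded part `A` and the remainder `R` of the statistic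
  set A : Ω → ℝ := fun ω => scaledPairSum g' (fun a => z a ω) (B j) with hA
  set R : Ω → ℝ := fun ω => scaledPairSum (fun x y => g x y - g' x y) (fun a => z a ω) (B j) with hR
  have hsplit (ω) : scaledPairSum g (fun a => z a ω) (B j) = A ω + R ω := by
    simp only [hA, hR, scaledPairSum, pairSum, rowSum, Finset.sum_sub_distrib]
    ring
  have hAb : IsBoundedVar A := by
    have hc : IsBoundedVar fun _ : Ω => 2 / ((B j : ℝ) - 1) :=
      ⟨measurable_const, _, fun _ => le_rfl⟩
    exact hc.mul (hz.isBoundedVar_pairSum hg' hM (B j))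
  have hRL : MemLp R 2 μ := hz.memLp_scaledPairSum hsubL (B j)
  have hA4 : ∫ ω, A ω ^ 4 ∂μ ≤ K := by
    simp only [hA, scaledPairSum, mul_pow]
    rw [integral_const_mul]
    have h4 := hz.integral_pairSum_pow_four_le hg' hM hdeg' (B j)
    have h5 : (B j : ℝ) / ((B j : ℝ) - 1) ≤ 2 := by
      rw [div_le_iff₀ hB1]; linarith
    calc (2 / ((B j : ℝ) - 1)) ^ 4 * ∫ ω, pairSum g' (fun a => z a ω) (B j) ^ 4 ∂μ
        ≤ (2 / ((B j : ℝ) - 1)) ^ 4 * (64 * (B j : ℝ) ^ 4 * M ^ 4) := by gcongr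
      _ = 16 * 64 * ((B j : ℝ) / ((B j : ℝ) - 1)) ^ 4 * M ^ 4 := by rw [div_pow, div_pow]; ring
      _ ≤ 16 * 64 * 2 ^ 4 * M ^ 4 := by gcongr
      _ = K := by rw [hK]; ring
  have hR2 : ∫ ω, R ω ^ 2 ∂μ ≤ ε / 8 := by
    simp only [hR]
    rw [hz.integral_scaledPairSum_sq hsubm hsubdeg hsubL hBj]
    have h5 : (B j : ℝ) / ((B j : ℝ) - 1) ≤ 2 := by
      rw [div_le_iff₀ hB1]; linarith
    calc 2 * ((B j : ℝ) / ((B j : ℝ) - 1)) * ∫ p, (g p.1 p.2 - g' p.1 p.2) ^ 2 ∂(ν.prod ν)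
        ≤ 2 * 2 * (ε / 32) := by gcongr
      _ = ε / 8 := by ring
  have hmem : MemLp (fun ω => A ω + R ω) 2 μ := by
    have := hz.memLp_scaledPairSum hL (B j)
    simpa only [hsplit] using this
  simp_rw [hsplit]
  calc ∫ ω, min ((A ω + R ω) ^ 2) (δ j * |A ω + R ω| ^ 3) ∂μ
      ≤ ∫ ω, (8 * δ j * (1 + A ω ^ 4) + 4 * R ω ^ 2) ∂μ := by
        refine integral_mono (integrable_min_sq_cube hmem (hδ0 j)) ?_ fun ω =>
          min_sq_cube_add_le (hδ0 j) _ _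
        exact (((integrable_const 1).add (hAb.pow 4).integrable).const_mul _).add
          (hRL.integrable_sq.const_mul 4)
    _ = 8 * δ j * (1 + ∫ ω, A ω ^ 4 ∂μ) + 4 * ∫ ω, R ω ^ 2 ∂μ := by
        rw [integral_add (((integrable_const 1).fun_add (hAb.pow 4).integrable).const_mul _)
          (hRL.integrable_sq.const_mul 4), integral_const_mul, integral_const_mul,
          integral_add (integrable_const 1) (hAb.pow 4).integrable]
        simp
    _ ≤ 8 * δ j * (1 + K) + ε / 2 := by
        have := hδ0 j
        have h6 : 8 * δ j * (1 + ∫ ω, A ω ^ 4 ∂μ) ≤ 8 * δ j * (1 + K) := by gcongr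
        linarith

end IsIIDSample

end BlockLindeberg

/-! ### Independent blocks and the averaged statistic -/

section Blocks

variable {Ω Z : Type*} [MeasurableSpace Ω] [MeasurableSpace Z] {z : ℕ → Ω → Z} {ν : Measure Z}
  {μ : Measure Ω} [IsProbabilityMeasure ν] [IsProbabilityMeasure μ] {g : Z → Z → ℝ}

namespace IsIIDSample

variable (hz : IsIIDSample z ν μ)
include hz

omit [IsProbabilityMeasure ν] [IsProbabilityMeasure μ] in
theorem shift (s : ℕ) : IsIIDSample (fun a => z (s + a)) ν μ :=
  ⟨fun _ => hz.measurable _, hz.indep.precomp (add_right_injective s), fun _ => hz.map_eq _⟩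

omit [IsProbabilityMeasure ν] [IsProbabilityMeasure μ] in
theorem map_eq_infinitePi : μ.map (fun ω a => z a ω) = Measure.infinitePi fun _ : ℕ => ν := by
  rw [hz.indep.map_fun_eq_infinitePi_map hz.measurable]
  simp_rw [hz.map_eq]

variable (hg : Measurable fun p : Z × Z => g p.1 p.2)
include hg

omit [IsProbabilityMeasure ν] [IsProbabilityMeasure μ] in
theorem map_pairSum_shift (s n : ℕ) :
    μ.map (fun ω => pairSum g (fun a => z (s + a) ω) n) =
      μ.map (fun ω => pairSum g (fun a => z a ω) n) := by
  have hm : Measurable fun x : ℕ → Z => pairSum g x n :=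
    measurable_pairSum (x := fun a (x : ℕ → Z) => x a) hg fun a _ => measurable_pi_apply a
  have key {y : ℕ → Ω → Z} (hy : IsIIDSample y ν μ) :
      μ.map (fun ω => pairSum g (fun a => y a ω) n) =
        (Measure.infinitePi fun _ : ℕ => ν).map fun x => pairSum g x n := by
    rw [← hy.map_eq_infinitePi, Measure.map_map hm (measurable_pi_iff.2 hy.measurable)]
    rfl
  rw [key hz, key (hz.shift s)]

omit [IsProbabilityMeasure ν] in
/-- The statistics of disjoint blocks are independent and identically distributed. -/
theorem charFun_sum_blocks (B m : ℕ) (t : ℝ) :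
    charFun (μ.map fun ω => ∑ i ∈ Finset.range m, pairSum g (fun a => z (i * B + a) ω) B) t =
      charFun (μ.map fun ω => pairSum g (fun a => z a ω) B) t ^ m := by
  induction m with
  | zero => simp
  | succ m ih =>
    -- `σ S` is generated by the sample points with index in `S`
    set σ : Set ℕ → MeasurableSpace Ω := fun S =>
      ⨆ a ∈ S, MeasurableSpace.comap (z a) inferInstance with hσ
    have hzσ {S : Set ℕ} {a : ℕ} (ha : a ∈ S) : Measurable[σ S] (z a) :=
      Measurable.of_comap_le (le_iSup₂_of_le (f := fun a (_ : a ∈ S) =>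
        MeasurableSpace.comap (z a) inferInstance) a ha le_rfl)
    have hle (S : Set ℕ) : σ S ≤ (inferInstance : MeasurableSpace Ω) :=
      iSup₂_le fun a _ => (hz.measurable a).comap_le
    have hind : Indep (σ (Set.Iio (m * B))) (σ (Set.Ici (m * B))) μ :=
      indep_iSup_of_disjoint (fun a => (hz.measurable a).comap_le)
        ((iIndepFun_iff_iIndep _ _ _).1 hz.indep)
        (Set.disjoint_left.2 fun a ha hb => absurd (Set.mem_Ici.1 hb) (not_le.2 (Set.mem_Iio.1 ha)))
    have h1 : Measurable[σ (Set.Iio (m * B))] fun ω =>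
        ∑ i ∈ Finset.range m, pairSum g (fun a => z (i * B + a) ω) B :=
      @Finset.measurable_fun_sum ℝ ℕ Ω _ _ _ (σ (Set.Iio (m * B))) _ _ fun i hi =>
        @measurable_pairSum Ω Z (σ (Set.Iio (m * B))) _ _ hg (fun a => z (i * B + a)) B
          fun a ha => hzσ <| by
            have hi' : (i + 1) * B ≤ m * B := Nat.mul_le_mul_right _ (Finset.mem_range.1 hi)
            rw [Set.mem_Iio]
            linarith
    have h2 : Measurable[σ (Set.Ici (m * B))] fun ω => pairSum g (fun a => z (m * B + a) ω) B :=
      @measurable_pairSum Ω Z (σ (Set.Ici (m * B))) _ _ hg (fun a => z (m * B + a)) B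
        fun a _ => hzσ <| by simp
    have hindF : IndepFun (fun ω => ∑ i ∈ Finset.range m, pairSum g (fun a => z (i * B + a) ω) B)
        (fun ω => pairSum g (fun a => z (m * B + a) ω) B) μ :=
      (IndepFun_iff_Indep _ _ _).2 (indep_of_indep_of_le_left
        (indep_of_indep_of_le_right hind h2.comap_le) h1.comap_le)
    simp_rw [Finset.sum_range_succ]
    rw [hindF.charFun_map_fun_add_eq_mul (h1.mono (hle _) le_rfl).aemeasurable
      (h2.mono (hle _) le_rfl).aemeasurable, Pi.mul_apply, ih, hz.map_pairSum_shift hg, pow_succ]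

end IsIIDSample

omit [MeasurableSpace Z] in
theorem sum_sum_ne_eq_two_mul_pairSum (hg : ∀ x y, g x y = g y x) (x : ℕ → Z) (n : ℕ) :
    ∑ a ∈ Finset.range n, ∑ b ∈ Finset.range n with b ≠ a, g (x a) (x b) = 2 * pairSum g x n := by
  simp_rw [Finset.sum_filter]
  induction n with
  | zero => simp [pairSum]
  | succ n ih =>
    rw [Finset.sum_range_succ, pairSum_succ, mul_add, ← ih]
    simp_rw [Finset.sum_range_succ _ n]
    rw [Finset.sum_add_distrib]
    have h1 : ∑ a ∈ Finset.range n, (if n ≠ a then g (x a) (x n) else 0) = rowSum g x n n :=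
      Finset.sum_congr rfl fun a ha => if_pos (by have := Finset.mem_range.1 ha; omega)
    have h2 : ∑ b ∈ Finset.range n, (if b ≠ n then g (x n) (x b) else 0) = rowSum g x n n :=
      Finset.sum_congr rfl fun b hb => by
        rw [if_pos (by have := Finset.mem_range.1 hb; omega), hg]
    rw [h1, h2]
    simp
    ring

end Blocks

section Statistic

variable {X : Type*} {k : X → X → ℝ}

theorem blockMMD_eq_pairSum (hk : ∀ x x', k x x' = k x' x) (z : ℕ → X × X) (B i : ℕ) :
    BTest.blockMMD k z B i =
      2 / ((B : ℝ) * ((B : ℝ) - 1)) * pairSum (BTest.core k) (fun a => z (i * B + a)) B := by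
  have hB : (i + 1) * B - i * B = B := by rw [← Nat.sub_mul]; simp
  rw [BTest.blockMMD, Finset.sum_Ico_eq_sum_range, hB]
  simp_rw [Finset.sum_filter, Finset.sum_Ico_eq_sum_range, hB]
  have h := sum_sum_ne_eq_two_mul_pairSum (core_comm hk) (fun a => z (i * B + a)) B
  simp_rw [Finset.sum_filter] at h
  have h' : ∀ a b : ℕ, (i * B + b ≠ i * B + a) ↔ b ≠ a := by intro a b; omega
  simp_rw [h', h]
  ring

end Statistic

section Asymptotics

/-- Rounding `n / B` down to the number of complete blocks does not matter in the limit. -/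
theorem tendsto_sqrt_ratio {n B : ℕ → ℕ} (hB : Tendsto B atTop atTop)
    (hnB : Tendsto (fun j => (n j : ℝ) / (B j : ℝ)) atTop atTop) :
    Tendsto (fun j => √((n j / B j : ℕ) : ℝ) *
      (√((n j : ℝ) * (B j : ℝ)) / (((n j / B j : ℕ) : ℝ) * B j))) atTop (𝓝 1) := by
  have h1 : Tendsto (fun j => (((n j / B j : ℕ) : ℝ) / ((n j : ℝ) / B j))) atTop (𝓝 1) := by
    have := (tendsto_nat_floor_div_atTop (R := ℝ)).comp hnB
    refine this.congr fun j => ?_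
    simp only [Function.comp]
    rw [Nat.floor_div_eq_div]
  have h2 := ((h1.inv₀ one_ne_zero).sqrt)
  rw [inv_one, Real.sqrt_one] at h2
  refine h2.congr' ?_
  filter_upwards [hB.eventually_gt_atTop 0, hnB.eventually_ge_atTop 1] with j hBj hnj
  have hB0 : (0 : ℝ) < B j := by exact_mod_cast hBj
  have hm : 0 < n j / B j := by
    rw [le_div_iff₀ hB0, one_mul] at hnj
    exact Nat.div_pos (by exact_mod_cast hnj) hBj
  have hm0 : (0 : ℝ) < ((n j / B j : ℕ) : ℝ) := by exact_mod_cast hm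
  have hden : ((n j / B j : ℕ) : ℝ) * B j = √((((n j / B j : ℕ) : ℝ) * B j) ^ 2) :=
    (Real.sqrt_sq (by positivity)).symm
  rw [hden, ← Real.sqrt_div (by positivity), ← Real.sqrt_mul (by positivity)]
  congr 1
  field_simp

theorem tendsto_div_atTop_of_tendsto {n B : ℕ → ℕ}
    (hnB : Tendsto (fun j => (n j : ℝ) / (B j : ℝ)) atTop atTop) :
    Tendsto (fun j => n j / B j) atTop atTop := by
  have := tendsto_nat_floor_atTop.comp hnB
  refine this.congr fun j => ?_
  simp only [Function.comp]
  rw [Nat.floor_div_eq_div]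

variable {Ω Z : Type*} [MeasurableSpace Ω] [MeasurableSpace Z] {z : ℕ → Ω → Z} {ν : Measure Z}
  {μ : Measure Ω} [IsProbabilityMeasure ν] [IsProbabilityMeasure μ] {g : Z → Z → ℝ}

/-- Convergence of the characteristic functions of the averaged block statistics. -/
theorem IsIIDSample.tendsto_charFun_average (hz : IsIIDSample z ν μ)
    (hg : Measurable fun p : Z × Z => g p.1 p.2) (hdeg : IsDegenerate g ν)
    (hL : MemLp (fun p : Z × Z => g p.1 p.2) 2 (ν.prod ν)) {n B : ℕ → ℕ}
    (hB : Tendsto B atTop atTop) (hnB : Tendsto (fun j => (n j : ℝ) / (B j : ℝ)) atTop atTop)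
    (t : ℝ) :
    Tendsto (fun j => charFun (μ.map fun ω => √((n j : ℝ) * (B j : ℝ)) *
        (1 / ((n j / B j : ℕ) : ℝ) * ∑ i ∈ Finset.range (n j / B j),
          2 / ((B j : ℝ) * ((B j : ℝ) - 1)) * pairSum g (fun a => z (i * B j + a) ω) (B j))) t)
      atTop (𝓝 (Complex.exp
        (-(t ^ 2 * (2 * ∫ p, g p.1 p.2 ^ 2 ∂(ν.prod ν)) : ℝ) / 2))) := by
  set m : ℕ → ℕ := fun j => n j / B j with hm
  have hmt : Tendsto m atTop atTop := tendsto_div_atTop_of_tendsto hnB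
  -- the argument at which the characteristic function of one scaled block has to be evaluated is
  -- `u j / √(m j)`
  set u : ℕ → ℝ := fun j => √(m j) * (√((n j : ℝ) * (B j : ℝ)) / ((m j : ℝ) * B j)) * t with hu
  have hut : Tendsto u atTop (𝓝 t) := by
    have := (tendsto_sqrt_ratio hB hnB).mul_const t
    rwa [one_mul] at this
  have hδ : Tendsto (fun j => (√(m j : ℝ))⁻¹) atTop (𝓝 0) :=
    tendsto_inv_atTop_zero.comp (Real.tendsto_sqrt_atTop.comp
      (tendsto_natCast_atTop_atTop.comp hmt))
  have hmain := tendsto_charFun_pow_of_lindeberg (μ := μ)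
    (Y := fun j ω => scaledPairSum g (fun a => z a ω) (B j)) hmt hut
    (fun j => hz.memLp_scaledPairSum hL (B j))
    (fun j => hz.integral_scaledPairSum hg hdeg hL (B j))
    ((hz.tendsto_integral_scaledPairSum_sq hg hdeg hL).comp hB)
    (hz.tendsto_lindeberg_scaledPairSum hg hdeg hL hB (fun j => by positivity) hδ)
  refine hmain.congr' ?_
  filter_upwards [hB.eventually_ge_atTop 2, hmt.eventually_gt_atTop 0] with j hBj hmj
  have hB2 : (2 : ℝ) ≤ B j := by exact_mod_cast hBj
  have hB1 : (B j : ℝ) - 1 ≠ 0 := by linarith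
  have hB0 : (B j : ℝ) ≠ 0 := by linarith
  have hm0 : (0 : ℝ) < m j := by exact_mod_cast hmj
  have hs0 : √(m j : ℝ) ≠ 0 := (Real.sqrt_pos.2 hm0).ne'
  set r : ℝ := √((n j : ℝ) * (B j : ℝ)) * (1 / (m j : ℝ) * (2 / ((B j : ℝ) * ((B j : ℝ) - 1))))
    with hr
  have hfun : (fun ω => √((n j : ℝ) * (B j : ℝ)) * (1 / (m j : ℝ) * ∑ i ∈ Finset.range (m j),
      2 / ((B j : ℝ) * ((B j : ℝ) - 1)) * pairSum g (fun a => z (i * B j + a) ω) (B j))) =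
      fun ω => r * ∑ i ∈ Finset.range (m j), pairSum g (fun a => z (i * B j + a) ω) (B j) := by
    ext ω
    rw [← Finset.mul_sum, hr]
    ring
  have hsum : Measurable fun ω =>
      ∑ i ∈ Finset.range (m j), pairSum g (fun a => z (i * B j + a) ω) (B j) :=
    Finset.measurable_fun_sum _ fun i _ => measurable_pairSum (x := fun a => z (i * B j + a)) hg
      fun a _ => hz.measurable _
  have h0 : Measurable fun ω => pairSum g (fun a => z a ω) (B j) :=
    measurable_pairSum hg fun a _ => hz.measurable _
  rw [hfun, charFun_map_mul_comp hsum.aemeasurable, hz.charFun_sum_blocks hg]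
  simp only [scaledPairSum]
  rw [charFun_map_mul_comp h0.aemeasurable]
  congr 2
  rw [hu, hr]
  field_simp

end Asymptotics

/-! ### The asymptotics of the B-test statistic -/

theorem mainTheorem1 {X : Type*} [MeasurableSpace X]
    {H : Type*} [NormedAddCommGroup H] [InnerProductSpace ℝ H] [CompleteSpace H] [RKHS ℝ H X ℝ]
    (k : X → X → ℝ) (hk : ∀ x x', k x x' = RKHS.kernel H x x' 1)
    (P Q : Measure X) [IsProbabilityMeasure P] [IsProbabilityMeasure Q]
    (hkP : Integrable (fun p : X × X => k p.1 p.2) (P.prod P))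
    (hh : MemLp (fun w : (X × X) × (X × X) => BTest.core k w.1 w.2) 2
      ((P.prod Q).prod (P.prod Q)))
    (hH0 : P = Q)
    {Ω : Type*} [MeasurableSpace Ω] (μ : Measure Ω) [IsProbabilityMeasure μ]
    (z : ℕ → Ω → X × X)
    (hz_law : ∀ a, HasLaw (z a) (P.prod Q) μ) (hz_indep : iIndepFun z μ) :
    -- the eigenvalues have finite multiplicity and are square summable
    (∀ l : ℝ, l ≠ 0 → FiniteDimensional ℝ (BTest.eigenspace k P l)) ∧
    Summable (BTest.eigenvalueTerm k P) ∧
    -- the variance of one block statistic is asymptotically `C / B ^ 2`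
    (∀ i : ℕ, (∀ B : ℕ, MemLp (fun ω => BTest.blockMMD k (fun a => z a ω) B i) 2 μ) ∧
      Tendsto (fun B : ℕ =>
        (B : ℝ) ^ 2 * variance (fun ω => BTest.blockMMD k (fun a => z a ω) B i) μ)
        atTop (𝓝 (BTest.nullConstant k P))) ∧
    -- asymptotic normality of the averaged statistic
    (∀ n B : ℕ → ℕ, Tendsto B atTop atTop →
      Tendsto (fun j => (n j : ℝ) / (B j : ℝ)) atTop atTop →
      TendstoInDistribution
        (fun j ω => √((n j : ℝ) * (B j : ℝ)) *
          BTest.statistic k (fun a => z a ω) (n j) (B j))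
        atTop (id : ℝ → ℝ) (fun _ => μ)
        (gaussianReal 0 (BTest.nullConstant k P).toNNReal)) := by
  subst hH0
  have hsymm (x x' : X) : k x x' = k x' x := by
    rw [hk, hk]
    have h1 : inner ℝ (RKHS.kerFun H x (1 : ℝ)) (RKHS.kerFun H x' (1 : ℝ)) = k x x' := by
      rw [RKHS.kerFun_inner, RKHS.kerFun_apply, hk]; simp
    have h2 : inner ℝ (RKHS.kerFun H x' (1 : ℝ)) (RKHS.kerFun H x (1 : ℝ)) = k x' x := by
      rw [RKHS.kerFun_inner, RKHS.kerFun_apply, hk]; simp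
    rw [← hk, ← hk, ← h1, ← h2, real_inner_comm]
  set ν := P.prod P with hν
  have hL := memLp_two_centredKernel_of_core hsymm hkP hh
  have hκsymm := centredKernel_comm (P := P) hsymm
  have hκdeg := isDegenerate_centredKernel hkP
  have hsum := hasSum_eigenvalueTerm hL hκsymm
  -- replace the core and the sample by measurable versions
  set g : X × X → X × X → ℝ := fun w w' => hh.1.mk _ (w, w') with hgdef
  have hg : Measurable fun p : (X × X) × (X × X) => g p.1 p.2 :=
    hh.1.stronglyMeasurable_mk.measurable
  have hgae : ∀ᵐ p ∂(ν.prod ν), BTest.core k p.1 p.2 = g p.1 p.2 := hh.1.ae_eq_mk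
  have hgL : MemLp (fun p : (X × X) × (X × X) => g p.1 p.2) 2 (ν.prod ν) := hh.ae_eq hgae
  have hcdeg : IsDegenerate (BTest.core k) ν := by
    have h := isDegenerate_core hκsymm hL hκdeg
    rw [IsDegenerate] at h ⊢
    simpa only [core_centredKernel hsymm] using h
  have hgdeg : IsDegenerate g ν := by
    have hsw : ∀ᵐ p ∂(ν.prod ν), BTest.core k p.2 p.1 = g p.2 p.1 :=
      Measure.measurePreserving_swap.quasiMeasurePreserving.ae hgae
    constructor
    · filter_upwards [Measure.ae_ae_of_ae_prod hgae, hcdeg.1] with x hx h0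
      rw [← h0]
      exact integral_congr_ae (hx.mono fun y hy => hy.symm)
    · filter_upwards [Measure.ae_ae_of_ae_prod hsw, hcdeg.2] with x hx h0
      rw [← h0]
      exact integral_congr_ae (hx.mono fun y hy => hy.symm)
  have hconst : 2 * ∫ p, g p.1 p.2 ^ 2 ∂(ν.prod ν) = BTest.nullConstant k P := by
    have h1 : ∫ p, g p.1 p.2 ^ 2 ∂(ν.prod ν) =
        4 * ∫ p, BTest.centredKernel k P p.1 p.2 ^ 2 ∂(P.prod P) := by
      rw [← integral_core_sq hκsymm hL hκdeg]
      refine integral_congr_ae ?_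
      filter_upwards [hgae] with p hp
      rw [← hp, core_centredKernel hsymm]
    rw [h1, BTest.nullConstant, hsum.tsum_eq]
    ring
  set y : ℕ → Ω → X × X := fun a => (hz_law a).aemeasurable.mk (z a) with hydef
  have hzy (a : ℕ) : z a =ᵐ[μ] y a := (hz_law a).aemeasurable.ae_eq_mk
  have hy : IsIIDSample y ν μ :=
    ⟨fun a => (hz_law a).aemeasurable.measurable_mk, hz_indep.congr hzy,
      fun a => by rw [← Measure.map_congr (hzy a), (hz_law a).map_eq]⟩
  -- almost surely, the block statistics are sums over pairs of the measurable versions; the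
  -- diagonal, on which the core and `g` may differ, does not enter
  have hae : ∀ᵐ ω ∂μ, ∀ B i, BTest.blockMMD k (fun a => z a ω) B i =
      2 / ((B : ℝ) * ((B : ℝ) - 1)) * pairSum g (fun a => y (i * B + a) ω) B := by
    have h1 : ∀ᵐ ω ∂μ, ∀ a, z a ω = y a ω := ae_all_iff.2 hzy
    have h2 : ∀ᵐ ω ∂μ, ∀ a b, a ≠ b → BTest.core k (y a ω) (y b ω) = g (y a ω) (y b ω) :=
      ae_all_iff.2 fun a => ae_all_iff.2 fun b => by
        by_cases hab : a = b
        · exact ae_of_all _ fun ω h => absurd hab h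
        · exact ((hy.measurePreserving_pair hab).quasiMeasurePreserving.ae hgae).mono
            fun ω h _ => h
    filter_upwards [h1, h2] with ω hω1 hω2 B i
    rw [blockMMD_eq_pairSum hsymm]
    congr 1
    refine Finset.sum_congr rfl fun b _ => Finset.sum_congr rfl fun a ha => ?_
    simp only [hω1]
    exact hω2 _ _ (by have := Finset.mem_range.1 ha; omega)
  have hblock (B i : ℕ) : (fun ω => BTest.blockMMD k (fun a => z a ω) B i) =ᵐ[μ]
      fun ω => 2 / ((B : ℝ) * ((B : ℝ) - 1)) * pairSum g (fun a => y (i * B + a) ω) B :=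
    hae.mono fun ω h => h B i
  have hblockL (B i : ℕ) : MemLp (fun ω => 2 / ((B : ℝ) * ((B : ℝ) - 1)) *
      pairSum g (fun a => y (i * B + a) ω) B) 2 μ :=
    ((hy.shift (i * B)).memLp_pairSum hgL B).const_mul _
  refine ⟨fun l hl => finiteDimensional_eigenspace hL hl, hsum.summable, fun i => ⟨fun B =>
    (hblockL B i).ae_eq (hblock B i).symm, ?_⟩, fun n B hB hnB => ?_⟩
  · rw [← hconst]
    refine (hy.tendsto_integral_scaledPairSum_sq hg hgdeg hgL).congr' ?_
    filter_upwards [eventually_ge_atTop 2] with B hB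
    have hB2 : (2 : ℝ) ≤ B := by exact_mod_cast hB
    have hB1 : (B : ℝ) - 1 ≠ 0 := by linarith
    have hB0 : (B : ℝ) ≠ 0 := by linarith
    rw [variance_congr (hblock B i), variance_eq_sub (hblockL B i), integral_const_mul,
      (hy.shift (i * B)).integral_pairSum hg hgdeg hgL, mul_zero,
      hy.integral_scaledPairSum_sq hg hgdeg hgL hB]
    simp only [Pi.pow_apply, mul_pow]
    rw [integral_const_mul, (hy.shift (i * B)).integral_pairSum_sq hg hgdeg hgL]
    field_simp
    ring
  · have hstat (j : ℕ) : (fun ω => √((n j : ℝ) * (B j : ℝ)) *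
        BTest.statistic k (fun a => z a ω) (n j) (B j)) =ᵐ[μ]
        fun ω => √((n j : ℝ) * (B j : ℝ)) * (1 / ((n j / B j : ℕ) : ℝ) *
          ∑ i ∈ Finset.range (n j / B j), 2 / ((B j : ℝ) * ((B j : ℝ) - 1)) *
            pairSum g (fun a => y (i * B j + a) ω) (B j)) := by
      filter_upwards [hae] with ω hω
      simp only [BTest.statistic, hω]
    have hmeas (j : ℕ) : AEMeasurable (fun ω => √((n j : ℝ) * (B j : ℝ)) *
        BTest.statistic k (fun a => z a ω) (n j) (B j)) μ := by
      refine AEMeasurable.congr (Measurable.aemeasurable ?_) (hstat j).symm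
      refine Measurable.const_mul (Measurable.const_mul (Finset.measurable_fun_sum _ fun i _ =>
        Measurable.const_mul ?_ _) _) _
      exact measurable_pairSum (x := fun a => y (i * B j + a)) hg fun a _ => hy.measurable _
    refine ⟨hmeas, aemeasurable_id, ?_⟩
    refine ProbabilityMeasure.tendsto_iff_tendsto_charFun.2 fun t => ?_
    have hC : 0 ≤ BTest.nullConstant k P := by
      rw [← hconst]
      exact mul_nonneg (by norm_num) (integral_nonneg fun _ => sq_nonneg _)
    have h := hy.tendsto_charFun_average hg hgdeg hgL hB hnB t
    rw [hconst] at h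
    simp only [ProbabilityMeasure.coe_mk, Measure.map_id, charFun_gaussianReal]
    convert! h using 2 with j
    · rw [Measure.map_congr (hstat j)]
    · congr 1
      rw [Real.coe_toNNReal _ hC]
      push_cast
      ring
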